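/- Let $n\ge 2$, let $\Omega\subset\mathbb R^n$ be a bounded Lipschitz domain, let $1<p\le q<\infty$, and let $a\in L^\infty(\Omega)$ with $a\ge 0$. Put $$W^{1,p,q}_a(\Omega)=\{w\in W^{1,p}(\Omega):\ a|\nabla w|^q\in L^1(\Omega)\},\qquad W^{1,p,q}_{a,0}(\Omega)=W^{1,p}_0(\Omega)\cap W^{1,p,q}_a(\Omega).$$ For $f\in W^{1,q}(\Omega)$, we say that $w\in W^{1,p,q}_a(\Omega)$ solves the double phase problem $$\operatorname{div}\big(|\nabla w|^{p-2}\nabla w+a|\nabla w|^{q-2}\nabla w\big)=0\ \text{ in }\Omega,\qquad w=f\ \text{ on }\partial\Omega,$$ if $w=f$ on $\partial\Omega$ in the sense of traces and $$\int_\Omega\big(|\nabla w|^{p-2}\nabla w+a|\nabla w|^{q-2}\nabla w\big)\cdot\nabla\varphi\,dx=0\qquad\text{for all }\varphi\in W^{1,p,q}_{a,0}(\Omega).$$ Let $u_0,v_0\in W^{1,q}(\Omega)$ satisfy $u_0\ge v_0$ on $\partial\Omega$ (almost everywhere, in the sense of traces), and let $u,v\in W^{1,p,q}_a(\Omega)$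 solve the double phase problem with boundary values $u_0$ and $v_0$, respectively. Then $u\ge v$ almost everywhere in $\Omega$. -/

import Mathlib

open MeasureTheory Filter Topology Set
open scoped ContDiff ENNReal NNReal

noncomputable section

namespace DoublePhase

/-- Euclidean space `ℝⁿ`. -/
abbrev E (n : ℕ) : Type := EuclideanSpace ℝ (Fin n)

/-- `Ω ⊆ ℝⁿ` is a bounded Lipschitz domain: a nonempty, connected, bounded open set which near
each of its boundary points is, in the direction of some unit vector `e`, the strict epigraph of
a Lipschitz function. The point `x - ⟪e, x⟫ e` is the orthogonal projection of `x` to the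
hyperplane `e^⊥`, so that only the values of `γ` on this hyperplane matter. -/
structure IsBoundedLipschitzDomain {n : ℕ} (Ω : Set (E n)) : Prop where
  isOpen : IsOpen Ω
  isConnected : IsConnected Ω
  isBounded : Bornology.IsBounded Ω
  lipschitz_boundary : ∀ x₀ ∈ frontier Ω, ∃ (e : E n) (γ : E n → ℝ) (K : ℝ≥0) (r : ℝ),
    ‖e‖ = 1 ∧ LipschitzWith K γ ∧ 0 < r ∧
      ∀ x ∈ Metric.ball x₀ r, x ∈ Ω ↔ γ (x - inner ℝ e x • e) < inner ℝ e x

/-- `ψ ∈ C_c^∞(Ω)`. -/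
def IsTestFunction {n : ℕ} (Ω : Set (E n)) (ψ : E n → ℝ) : Prop :=
  ContDiff ℝ ∞ ψ ∧ HasCompactSupport ψ ∧ tsupport ψ ⊆ Ω

/-- `G` is the distributional gradient of `u` in `Ω`; both are locally integrable in `Ω`. -/
def IsWeakGradient {n : ℕ} (Ω : Set (E n)) (u : E n → ℝ) (G : E n → E n) : Prop :=
  LocallyIntegrableOn u Ω ∧ LocallyIntegrableOn G Ω ∧
    ∀ ψ : E n → ℝ, IsTestFunction Ω ψ → ∀ i : Fin n,
      ∫ x in Ω, u x * gradient ψ x i = -∫ x in Ω, G x i * ψ x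

open Classical in
/-- The weak gradient `∇u` in `Ω`, unique up to null sets when it exists
(and `0` by convention when it does not exist). -/
def weakGradient {n : ℕ} (Ω : Set (E n)) (u : E n → ℝ) : E n → E n :=
  if h : ∃ G, IsWeakGradient Ω u G then h.choose else 0

theorem isWeakGradient_weakGradient {n : ℕ} {Ω : Set (E n)} {u : E n → ℝ}
    (h : ∃ G, IsWeakGradient Ω u G) : IsWeakGradient Ω u (weakGradient Ω u) := by
  unfold weakGradient
  rw [dif_pos h]
  exact h.choose_spec

/-- `u ∈ W^{1,p}(Ω)`. -/
def MemSobolev {n : ℕ} (Ω : Set (E n)) (p : ℝ) (u : E n → ℝ) : Prop :=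
  MemLp u (ENNReal.ofReal p) (volume.restrict Ω) ∧
    (∃ G, IsWeakGradient Ω u G) ∧
    MemLp (weakGradient Ω u) (ENNReal.ofReal p) (volume.restrict Ω)

/-- The smooth functions `φ k` converge to `u` in the norm of `W^{1,p}(Ω)`. -/
def SobolevTendsto {n : ℕ} (Ω : Set (E n)) (p : ℝ) (φ : ℕ → E n → ℝ) (u : E n → ℝ) : Prop :=
  Tendsto (fun k => eLpNorm (fun x => φ k x - u x) (ENNReal.ofReal p) (volume.restrict Ω))
      atTop (𝓝 0) ∧
    Tendsto (fun k => eLpNorm (fun x => gradient (φ k) x - weakGradient Ω u x)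
      (ENNReal.ofReal p) (volume.restrict Ω)) atTop (𝓝 0)

/-- `u ∈ W^{1,p}_0(Ω)`, the closure of `C_c^∞(Ω)` in `W^{1,p}(Ω)`. -/
def MemSobolevZero {n : ℕ} (Ω : Set (E n)) (p : ℝ) (u : E n → ℝ) : Prop :=
  MemSobolev Ω p u ∧
    ∃ φ : ℕ → E n → ℝ, (∀ k, IsTestFunction Ω (φ k)) ∧ SobolevTendsto Ω p φ u

/-- The surface measure on `∂Ω`: the `(n-1)`-dimensional Hausdorff measure (up to a positive
normalizing constant, which plays no role here). -/
def surfaceMeasure {n : ℕ} (Ω : Set (E n)) : Measure (E n) :=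
  (Measure.hausdorffMeasure ((n : ℝ) - 1)).restrict (frontier Ω)

/-- `g ∈ L^p(∂Ω)` is the trace of `u ∈ W^{1,p}(Ω)`: the trace operator is the continuous extension
to `W^{1,p}(Ω)` of the restriction to `∂Ω` of functions that are smooth up to the boundary. -/
def IsTrace {n : ℕ} (Ω : Set (E n)) (p : ℝ) (u g : E n → ℝ) : Prop :=
  MemSobolev Ω p u ∧ MemLp g (ENNReal.ofReal p) (surfaceMeasure Ω) ∧
    ∃ φ : ℕ → E n → ℝ, (∀ k, ContDiff ℝ ∞ (φ k)) ∧ SobolevTendsto Ω p φ u ∧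
      Tendsto (fun k => eLpNorm (fun x => φ k x - g x) (ENNReal.ofReal p) (surfaceMeasure Ω))
        atTop (𝓝 0)

/-- `u = f` on `∂Ω` in the sense of traces (of functions in `W^{1,p}(Ω)`). -/
def BoundaryEq {n : ℕ} (Ω : Set (E n)) (p : ℝ) (u f : E n → ℝ) : Prop :=
  ∃ g : E n → ℝ, IsTrace Ω p u g ∧ IsTrace Ω p f g

/-- `u ≤ w` on `∂Ω` in the sense of traces (of functions in `W^{1,p}(Ω)`). -/
def BoundaryLE {n : ℕ} (Ω : Set (E n)) (p : ℝ) (u w : E n → ℝ) : Prop :=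
  ∃ g h : E n → ℝ, IsTrace Ω p u g ∧ IsTrace Ω p w h ∧ g ≤ᵐ[surfaceMeasure Ω] h

/-- `u ∈ W^{1,p,q}_a(Ω)`: `u ∈ W^{1,p}(Ω)` and `a |∇u|^q ∈ L¹(Ω)`. -/
def MemDoublePhase {n : ℕ} (Ω : Set (E n)) (a : E n → ℝ) (p q : ℝ) (u : E n → ℝ) : Prop :=
  MemSobolev Ω p u ∧ IntegrableOn (fun x => a x * ‖weakGradient Ω u x‖ ^ q) Ω

/-- `u ∈ W^{1,p,q}_{a,0}(Ω) = W^{1,p}_0(Ω) ∩ W^{1,p,q}_a(Ω)`. -/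
def MemDoublePhaseZero {n : ℕ} (Ω : Set (E n)) (a : E n → ℝ) (p q : ℝ) (u : E n → ℝ) : Prop :=
  MemSobolevZero Ω p u ∧ MemDoublePhase Ω a p q u

/-- The vector `|ξ|^{r-2} ξ`, which is `0` for `ξ = 0`. -/
def powerVec {n : ℕ} (r : ℝ) (ξ : E n) : E n := ‖ξ‖ ^ (r - 2) • ξ

/-- `u ∈ W^{1,p,q}_a(Ω)` is a (weak) solution of the Dirichlet problem
`div (|∇u|^{p-2} ∇u + a |∇u|^{q-2} ∇u) = 0` in `Ω`, `u = f` on `∂Ω`. -/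
structure IsSolution {n : ℕ} (Ω : Set (E n)) (a : E n → ℝ) (p q : ℝ) (f u : E n → ℝ) :
    Prop where
  mem : MemDoublePhase Ω a p q u
  weak_eq : ∀ φ : E n → ℝ, MemDoublePhaseZero Ω a p q φ →
    ∫ x in Ω, inner ℝ (powerVec p (weakGradient Ω u x) + a x • powerVec q (weakGradient Ω u x))
      (weakGradient Ω φ x) = 0
  boundary : BoundaryEq Ω p u f

end DoublePhase

end

/-!
Let `w = v - u`. The positive part `w⁺`, extended by zero outside `Ω`, is an admissible test
function in both equations. Subtracting the two tested equations gives
`∫_{w > 0} (A(x, ∇v) - A(x, ∇u)) · (∇v - ∇u) = 0` with `A(x, ξ) = |ξ|^{p-2} ξ + a(x) |ξ|^{q-2} ξ`;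
strict monotonicity of `ξ ↦ |ξ|^{p-2} ξ`
(`eq_of_inner_powerVec_sub_eq_zero`) forces `∇w⁺ = 0`, and a function of
`W^{1,p}(ℝⁿ)` with bounded support and zero gradient vanishes (`IsWeakGradient.ae_eq_zero`). The
work lies in showing that `w⁺ ∈ W^{1,p}_0(Ω)`.

*Boundary values.* Writing `v - u = (v - v₀) + (v₀ - u₀) + (u₀ - u)` yields smooth functions `φ k`
that converge to `w` in `W^{1,p}(Ω)` and to some `g ≤ 0` in `L^p(∂Ω)`
(`hasSmoothApprox_sub_of_boundary`); uniqueness of traces is not used.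

*Integration by parts.* Near each boundary point, `Ω` is the region above the graph of a Lipschitz
function, and it has this form in all directions `d` of an open cone (`IsConeChart`). On each line
in such a direction the fundamental theorem of calculus expresses the integral of `∂_d F` over `Ω`
by a single boundary value of `F`. Since orthogonal projections are `1`-Lipschitz, Hausdorff
measure on `∂Ω` dominates Lebesgue measure on the hyperplane of these lines, so that
`|∫_Ω ∂_d F| ≤ C ‖F‖_{L^p(∂Ω)}` (`IsConeChart.enorm_integral_fderiv_le`). The cone spans the space and a
partition of unity makes the estimate global: if `F_k → 0` in `L^p(∂Ω)` then `∫_Ω ∂_d F_k → 0` for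
every `d` (`IsBoundedLipschitzDomain.tendsto_integral_fderiv`). Applied to `F_k = β(φ k) ψ`, with
`β` a `C¹` approximation of the positive part and `ψ` a test function on the whole space, this
shows that the extension of `w⁺` by zero has the weak gradient `1_{w > 0} ∇w` on the whole space
(`isWeakGradient_univ_posPart`).

*Approximation.* A function on the whole space that vanishes outside `Ω` is cut into pieces
supported in charts, and each piece is mollified with kernels supported in the cone of the chart,
which pushes its support into `Ω` (`IsConeChart.exists_testFunction_tendsto`). The mollified
functions converge in `L^p` by continuity of translations.
-/

noncomputable section

namespace DoublePhase

/-! ### Charts and partitions of unity -/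

/-- Near `x₀` the set `Ω` is `{G > 0}`, where `G` increases at rate at least `1/2` in every
direction of the ball of radius `δ` about `e`. For a point of the boundary of a Lipschitz domain
this is the usual graph chart; interior and exterior points have (trivial) charts as well, so that
no case distinction is needed when charts are glued. -/
structure IsConeChart {n : ℕ} (Ω : Set (E n)) (x₀ e : E n) (G : E n → ℝ) (r δ : ℝ) : Prop where
  r_pos : 0 < r
  δ_pos : 0 < δ
  continuous : Continuous G
  mem_iff : ∀ x ∈ Metric.ball x₀ r, x ∈ Ω ↔ 0 < G x
  increasing : ∀ d ∈ Metric.ball e δ, ∀ x, ∀ t : ℝ, 0 ≤ t → G x + t / 2 ≤ G (x + t • d)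

theorem isConeChart_affine {n : ℕ} {Ω : Set (E n)} {x₀ e : E n} {r M : ℝ} (hr : 0 < r)
    (he : ‖e‖ = 1)
    (h : ∀ x ∈ Metric.ball x₀ r, x ∈ Ω ↔ 0 < inner ℝ e x + M) :
    IsConeChart Ω x₀ e (fun x => inner ℝ e x + M) r (1 / 2) where
  r_pos := hr
  δ_pos := by norm_num
  continuous := by fun_prop
  mem_iff := h
  increasing d hd x t ht := by
    have h1 : inner ℝ e d = 1 + inner ℝ e (d - e) := by
      rw [inner_sub_right, real_inner_self_eq_norm_sq, he]; ring
    have h2 : |inner ℝ e (d - e)| ≤ ‖e‖ * ‖d - e‖ := abs_real_inner_le_norm _ _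
    rw [he, one_mul] at h2
    have h3 : ‖d - e‖ < 1 / 2 := by rwa [← dist_eq_norm, ← Metric.mem_ball]
    have h4 : (1 : ℝ) / 2 ≤ inner ℝ e d := by
      have := neg_abs_le (inner ℝ e (d - e)); linarith
    rw [inner_add_right, inner_smul_right]
    nlinarith

theorem isConeChart_epigraph {n : ℕ} {Ω : Set (E n)} {x₀ e : E n} {r : ℝ} {γ : E n → ℝ} {K : ℝ≥0}
    (hr : 0 < r) (he : ‖e‖ = 1) (hγ : LipschitzWith K γ)
    (h : ∀ x ∈ Metric.ball x₀ r, x ∈ Ω ↔ γ (x - inner ℝ e x • e) < inner ℝ e x) :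
    IsConeChart Ω x₀ e (fun x => inner ℝ e x - γ (x - inner ℝ e x • e)) r (1 / (2 + 4 * K)) where
  r_pos := hr
  δ_pos := by positivity
  continuous := by have := hγ.continuous; fun_prop
  mem_iff x hx := by rw [h x hx, sub_pos]
  increasing d hd x t ht := by
    set δ : ℝ := 1 / (2 + 4 * K)
    have hK : (0 : ℝ) ≤ K := K.2
    have hδ : δ * (1 + 2 * K) = 1 / 2 := by
      simp only [δ]; field_simp; ring
    have h1 : inner ℝ e d = 1 + inner ℝ e (d - e) := by
      rw [inner_sub_right, real_inner_self_eq_norm_sq, he]; ring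
    have h2 : |inner ℝ e (d - e)| ≤ ‖e‖ * ‖d - e‖ := abs_real_inner_le_norm _ _
    rw [he, one_mul] at h2
    have h3 : ‖d - e‖ < δ := by rwa [← dist_eq_norm, ← Metric.mem_ball]
    have h4 : 1 - δ ≤ inner ℝ e d := by
      have := neg_abs_le (inner ℝ e (d - e)); linarith
    have h5 : ‖d - inner ℝ e d • e‖ ≤ 2 * δ := by
      have : d - inner ℝ e d • e = (d - e) - inner ℝ e (d - e) • e := by
        rw [h1, add_smul, one_smul]; abel
      rw [this]
      refine (norm_sub_le _ _).trans ?_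
      rw [norm_smul, he, mul_one, Real.norm_eq_abs]
      linarith
    have h6 := hγ.dist_le_mul (x + t • d - inner ℝ e (x + t • d) • e) (x - inner ℝ e x • e)
    have h7 : x + t • d - inner ℝ e (x + t • d) • e - (x - inner ℝ e x • e)
        = t • (d - inner ℝ e d • e) := by
      rw [inner_add_right, inner_smul_right, smul_sub, add_smul, smul_smul]; abel
    rw [dist_eq_norm, dist_eq_norm, h7, norm_smul, Real.norm_eq_abs, Real.norm_eq_abs,
      abs_of_nonneg ht] at h6
    have h8 := (le_abs_self _).trans h6
    have h9 : (K : ℝ) * (t * ‖d - inner ℝ e d • e‖) ≤ K * (t * (2 * δ)) := by gcongr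
    rw [inner_add_right, inner_smul_right] at *
    nlinarith

/-- Every point of the space has a cone chart. -/
theorem IsBoundedLipschitzDomain.exists_isConeChart {n : ℕ} [NeZero n] {Ω : Set (E n)}
    (hΩ : IsBoundedLipschitzDomain Ω) (x₀ : E n) :
    ∃ e G r δ, IsConeChart Ω x₀ e G r δ := by
  obtain ⟨e, he⟩ : ∃ e : E n, ‖e‖ = 1 := ⟨EuclideanSpace.single 0 1, by simp⟩
  by_cases hf : x₀ ∈ frontier Ω
  · obtain ⟨e, γ, K, r, he, hγ, hr, h⟩ := hΩ.lipschitz_boundary x₀ hf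
    exact ⟨e, _, r, _, isConeChart_epigraph hr he hγ h⟩
  have hb : ∀ x ∈ Metric.ball x₀ 1, |inner ℝ e x| < ‖x₀‖ + 1 := by
    intro x hx
    have h1 := abs_real_inner_le_norm e x
    rw [he, one_mul] at h1
    have h2 := norm_le_norm_add_norm_sub' x x₀
    rw [Metric.mem_ball, dist_eq_norm] at hx
    linarith
  by_cases hi : x₀ ∈ Ω
  · obtain ⟨r, hr, hr'⟩ := Metric.isOpen_iff.1 hΩ.isOpen x₀ hi
    refine ⟨e, _, min r 1, _, isConeChart_affine (M := ‖x₀‖ + 1) (by positivity) he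
      fun x hx => iff_of_true (hr' ?_) ?_⟩
    · exact Metric.ball_subset_ball (min_le_left _ _) hx
    · have := (abs_lt.1 (hb x (Metric.ball_subset_ball (min_le_right _ _) hx))).1
      linarith
  · have hc : x₀ ∈ (closure Ω)ᶜ := by
      intro hc
      exact hf ⟨hc, by rwa [hΩ.isOpen.interior_eq]⟩
    obtain ⟨r, hr, hr'⟩ := Metric.isOpen_iff.1 isClosed_closure.isOpen_compl x₀ hc
    refine ⟨e, _, min r 1, _, isConeChart_affine (M := -(‖x₀‖ + 1)) (by positivity) he
      fun x hx => iff_of_false (fun h => ?_) ?_⟩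
    · exact hr' (Metric.ball_subset_ball (min_le_left _ _) hx) (subset_closure h)
    · have := (abs_lt.1 (hb x (Metric.ball_subset_ball (min_le_right _ _) hx))).2
      linarith

theorem exists_finite_smooth_partition {n : ℕ} {Ω : Set (E n)} (hΩ : Bornology.IsBounded Ω)
    (r : E n → ℝ) (hr : ∀ x, 0 < r x) :
    ∃ (t : Finset (E n)) (η : E n → E n → ℝ),
      (∀ i ∈ t, ContDiff ℝ ∞ (η i) ∧ HasCompactSupport (η i) ∧
        tsupport (η i) ⊆ Metric.ball i (r i)) ∧
      ∀ x ∈ closure Ω, ∑ i ∈ t, η i x = 1 := by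
  obtain ⟨ρ, hρ⟩ := SmoothPartitionOfUnity.exists_isSubordinate (modelWithCornersSelf ℝ (E n))
    (isClosed_closure (s := Ω)) (fun x : E n => Metric.ball x (r x))
    (fun _ => Metric.isOpen_ball)
    (fun x _ => mem_iUnion.2 ⟨x, Metric.mem_ball_self (hr x)⟩)
  have hcpt : IsCompact (closure Ω) := hΩ.isCompact_closure
  have hfin := ρ.locallyFinite.finite_nonempty_inter_compact hcpt
  refine ⟨hfin.toFinset, fun i => ρ i, fun i _ => ⟨(ρ i).contMDiff.contDiff, ?_, hρ i⟩,
    fun x hx => ?_⟩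
  · exact (isCompact_closedBall i (r i)).of_isClosed_subset (isClosed_tsupport _)
      ((hρ i).trans Metric.ball_subset_closedBall)
  · rw [← ρ.sum_eq_one hx]
    refine (finsum_eq_sum_of_support_subset _ fun i hi => ?_).symm
    simp only [Finite.coe_toFinset, mem_ofPred_eq]
    exact ⟨x, hi, hx⟩

/-! ### Boundary estimate for integrals of directional derivatives -/

/-- Hausdorff measure dominates the Lebesgue measure of 1-Lipschitz images, integrated form: if
each value `f y` is at most the value of `h` at some point of `S` above `y`, then
`∫ f ≤ ∫_S h dH^m`. Thanks to the layer cake formula no measurable choice of that point is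
needed. -/
theorem lintegral_le_of_le_on_fiber {m : ℕ} {X : Type*} [EMetricSpace X] [MeasurableSpace X]
    [BorelSpace X] {P : X → (Fin m → ℝ)} (hP : LipschitzWith 1 P) (S : Set X) {h : X → ℝ}
    (hh : Measurable h) (hh0 : ∀ x, 0 ≤ h x) {f : (Fin m → ℝ) → ℝ} (hf : Measurable f)
    (hf0 : ∀ y, 0 ≤ f y) (hfh : ∀ y, f y ≠ 0 → ∃ x ∈ S, P x = y ∧ f y ≤ h x) :
    ∫⁻ y, ENNReal.ofReal (f y) ≤
      ∫⁻ x, ENNReal.ofReal (h x) ∂((Measure.hausdorffMeasure (m : ℝ)).restrict S) := by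
  rw [lintegral_eq_lintegral_meas_lt _ (ae_of_all _ hf0) hf.aemeasurable,
    lintegral_eq_lintegral_meas_lt _ (ae_of_all _ hh0) hh.aemeasurable]
  refine setLIntegral_mono' measurableSet_Ioi fun c (hc : 0 < c) => ?_
  rw [Measure.restrict_apply (measurableSet_lt measurable_const hh)]
  have hsub : {y | c < f y} ⊆ P '' ({x | c < h x} ∩ S) := by
    intro y (hy : c < f y)
    obtain ⟨x, hx, rfl, hle⟩ := hfh y (hc.trans hy).ne'
    exact ⟨x, ⟨hy.trans_le hle, hx⟩, rfl⟩
  have h1 := hP.hausdorffMeasure_image_le (d := m) (by positivity) ({x | c < h x} ∩ S)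
  rw [ENNReal.coe_one, ENNReal.one_rpow, one_mul] at h1
  refine (measure_mono hsub).trans (le_trans (le_of_eq ?_) h1)
  have := hausdorffMeasure_pi_real (ι := Fin m)
  rw [Fintype.card_fin] at this
  rw [this]

/-- Orthonormal coordinates `(t, y)` with `t` in the direction `d`; the second component `P` of the
inverse is `1`-Lipschitz. -/
theorem exists_directional_coordinates {m : ℕ} {d : E (m + 1)} (hd : ‖d‖ = 1) :
    ∃ (Φ : ℝ × (Fin m → ℝ) ≃ᵐ E (m + 1)) (P : E (m + 1) → (Fin m → ℝ)),
      MeasurePreserving Φ ∧ LipschitzWith 1 P ∧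
      (∀ t y, P (Φ (t, y)) = y) ∧ ∀ t y, Φ (t, y) = Φ (0, y) + t • d := by
  obtain ⟨B, hB⟩ := Orthonormal.exists_orthonormalBasis_extension_of_card_eq (𝕜 := ℝ)
    (E := E (m + 1)) (ι := Fin (m + 1)) (by simp) (v := fun _ => d) (s := {0}) (by
      rw [orthonormal_iff_ite]
      rintro ⟨i, rfl⟩ ⟨j, rfl⟩
      simp [hd])
  have hB0 : B 0 = d := hB 0 rfl
  let Φ : ℝ × (Fin m → ℝ) ≃ᵐ E (m + 1) :=
    ((MeasurableEquiv.piFinSuccAbove (fun _ : Fin (m + 1) => ℝ) 0).symm.trans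
      (MeasurableEquiv.toLp 2 (Fin (m + 1) → ℝ))).trans B.repr.symm.toMeasurableEquiv
  have hΦ : ∀ t y, Φ (t, y) = B.repr.symm (WithLp.toLp 2 (Fin.cons t y : Fin (m + 1) → ℝ)) := by
    intro t y
    change B.repr.symm (WithLp.toLp 2 (Fin.insertNth 0 t y : Fin (m + 1) → ℝ)) = _
    rw [Fin.insertNth_zero']
  refine ⟨Φ, fun x j => B.repr x j.succ, ?_, ?_, ?_, ?_⟩
  · refine (B.measurePreserving_repr_symm).comp ((PiLp.volume_preserving_toLp _).comp
      (volume_preserving_piFinSuccAbove (fun _ : Fin (m + 1) => ℝ) 0).symm)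
  · refine LipschitzWith.of_dist_le_mul fun x y => ?_
    rw [NNReal.coe_one, one_mul, dist_pi_le_iff dist_nonneg]
    intro j
    rw [← B.repr.dist_map x y, dist_eq_norm, dist_eq_norm, ← PiLp.sub_apply]
    exact PiLp.norm_apply_le _ _
  · intro t y
    ext j
    simp [hΦ]
  · intro t y
    rw [hΦ, hΦ, ← hB0]
    apply B.repr.injective
    rw [map_add, map_smul, LinearIsometryEquiv.apply_symm_apply,
      LinearIsometryEquiv.apply_symm_apply, B.repr_self]
    ext i
    refine Fin.cases ?_ (fun j => ?_) i <;> simp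

/-- On a line in a cone direction `d` of the chart, `Ω` is a half-line as far as a function `F`
supported in the chart can see, so that the fundamental theorem of calculus leaves a single boundary
value. -/
theorem IsConeChart.exists_frontier_line_integral_eq {n : ℕ} {Ω : Set (E n)} {x₀ e : E n}
    {G : E n → ℝ} {r δ : ℝ} (hC : IsConeChart Ω x₀ e G r δ) (hΩ : IsOpen Ω) {d d₁ : E n}
    (hd : d ∈ Metric.ball e δ) {τ : ℝ} (hτ : 0 < τ) (hd₁ : d₁ = τ • d) (hd₁' : ‖d₁‖ = 1)
    {F : E n → ℝ} (hF : ContDiff ℝ 1 F) (hF' : tsupport F ⊆ Metric.ball x₀ r) (z : E n)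
    (h0 : ∫ t : ℝ, Ω.indicator (fun x => fderiv ℝ F x d₁) (z + t • d₁) ≠ 0) :
    ∃ t : ℝ, z + t • d₁ ∈ frontier Ω ∧
      ∫ s : ℝ, Ω.indicator (fun x => fderiv ℝ F x d₁) (z + s • d₁) = - F (z + t • d₁) := by
  have hinc : ∀ x, ∀ t : ℝ, 0 ≤ t → G x + t * τ / 2 ≤ G (x + t • d₁) := by
    intro x t ht
    have := hC.increasing d hd x (t * τ) (by positivity)
    rwa [hd₁, smul_smul]
  set g : ℝ → ℝ := fun t => G (z + t • d₁) with hg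
  have hgc : Continuous g := hC.continuous.comp (by fun_prop)
  have hg2 : ∀ s t, s ≤ t → g s + (t - s) * τ / 2 ≤ g t := by
    intro s t hst
    have := hinc (z + s • d₁) (t - s) (by linarith)
    rwa [add_assoc, ← add_smul, add_sub_cancel] at this
  have hmono : StrictMono g := by
    intro s t hst
    have := hg2 s t hst.le
    have : 0 < (t - s) * τ / 2 := by have := sub_pos.2 hst; positivity
    linarith
  obtain ⟨t₀, ht₀⟩ : ∃ t, g t = 0 := by
    have h1 : ∃ t, g t ≤ 0 := by
      refine ⟨-(2 * |g 0| / τ), ?_⟩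
      have h2 := hg2 (-(2 * |g 0| / τ)) 0 (neg_nonpos.2 (by positivity))
      have h3 : (0 - -(2 * |g 0| / τ)) * τ / 2 = |g 0| := by field_simp; ring
      have := le_abs_self (g 0)
      linarith
    have h1' : ∃ t, 0 ≤ g t := by
      refine ⟨2 * |g 0| / τ, ?_⟩
      have h2 := hg2 0 (2 * |g 0| / τ) (by positivity)
      have h3 : (2 * |g 0| / τ - 0) * τ / 2 = |g 0| := by field_simp; ring
      have := neg_abs_le (g 0)
      linarith
    obtain ⟨a, ha⟩ := h1
    obtain ⟨b, hb⟩ := h1'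
    exact mem_range_of_exists_le_of_exists_ge hgc ⟨a, ha⟩ ⟨b, hb⟩
  have hFd : ∀ t, HasDerivAt (fun t : ℝ => F (z + t • d₁)) (fderiv ℝ F (z + t • d₁) d₁) t := by
    intro t
    have h1 : HasDerivAt (fun t : ℝ => z + t • d₁) d₁ t := by
      simpa using ((hasDerivAt_id t).smul_const d₁).const_add z
    exact ((hF.differentiable one_ne_zero _).hasFDerivAt).comp_hasDerivAt t h1
  have hcs : HasCompactSupport F :=
    (isCompact_closedBall x₀ r).of_isClosed_subset (isClosed_tsupport _)
      (hF'.trans Metric.ball_subset_closedBall)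
  have hiso : Isometry (fun t : ℝ => z + t • d₁) := by
    refine Isometry.of_dist_eq fun s t => ?_
    rw [dist_add_left, dist_eq_norm, ← sub_smul, norm_smul, hd₁', mul_one, ← dist_eq_norm]
  have key : ∫ s : ℝ, Ω.indicator (fun x => fderiv ℝ F x d₁) (z + s • d₁)
      = - F (z + t₀ • d₁) := by
    have h1 : ContDiff ℝ 1 (fun t : ℝ => F (z + t • d₁)) := hF.comp (by fun_prop)
    have h2 : HasCompactSupport (fun t : ℝ => F (z + t • d₁)) :=
      hcs.comp_isClosedEmbedding hiso.isClosedEmbedding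
    rw [← h2.integral_Ioi_deriv_eq h1 t₀, ← integral_indicator measurableSet_Ioi]
    congr 1 with s
    by_cases hs : z + s • d₁ ∈ Metric.ball x₀ r
    · have h3 : z + s • d₁ ∈ Ω ↔ s ∈ Ioi t₀ := by
        rw [hC.mem_iff _ hs, mem_Ioi, ← hmono.lt_iff_lt (a := t₀), ht₀]
      by_cases h4 : s ∈ Ioi t₀
      · rw [indicator_of_mem (h3.2 h4), indicator_of_mem h4, (hFd s).deriv]
      · rw [indicator_of_notMem (fun h => h4 (h3.1 h)), indicator_of_notMem h4]
    · have h5 : fderiv ℝ F (z + s • d₁) = 0 :=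
        image_eq_zero_of_notMem_tsupport fun h => hs (hF' (tsupport_fderiv_subset ℝ h))
      simp [indicator_apply, (hFd s).deriv, h5]
  refine ⟨t₀, ?_, key⟩
  have hFne : F (z + t₀ • d₁) ≠ 0 := by
    rw [key] at h0; exact neg_ne_zero.1 h0
  have hmem : z + t₀ • d₁ ∈ Metric.ball x₀ r := hF' (subset_tsupport _ hFne)
  rw [hΩ.frontier_eq]
  refine ⟨?_, fun h => ?_⟩
  · -- the points above `t₀` close to it lie in `Ω`
    have hc : Continuous fun t : ℝ => z + t • d₁ := by fun_prop
    have h6 : ∀ᶠ t in 𝓝[>] t₀, z + t • d₁ ∈ Ω := by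
      have : ∀ᶠ t in 𝓝[>] t₀, z + t • d₁ ∈ Metric.ball x₀ r :=
        (hc.tendsto t₀).mono_left nhdsWithin_le_nhds (Metric.isOpen_ball.mem_nhds hmem)
      filter_upwards [this, self_mem_nhdsWithin] with t ht ht'
      rw [hC.mem_iff _ ht]
      exact ht₀ ▸ hmono ht'
    exact mem_closure_of_tendsto ((hc.tendsto t₀).mono_left nhdsWithin_le_nhds) h6
  · exact ((hC.mem_iff _ hmem).1 h).ne' ht₀

/-- A function supported in a chart satisfies `|∫_Ω ∂_d F| ≤ C ‖F‖_{L^p(∂Ω)}` for `d` in the cone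
of the chart. -/
theorem IsConeChart.enorm_integral_fderiv_le {m : ℕ} {Ω : Set (E (m + 1))} {x₀ e : E (m + 1)}
    {G : E (m + 1) → ℝ} {r δ : ℝ} (hC : IsConeChart Ω x₀ e G r δ) (hΩ : IsOpen Ω)
    {d : E (m + 1)} (hd : d ∈ Metric.ball e δ) {p : ℝ} (hp : 1 ≤ p) :
    ∃ C : ℝ≥0∞, C ≠ ⊤ ∧ ∀ F : E (m + 1) → ℝ, ContDiff ℝ 1 F → tsupport F ⊆ Metric.ball x₀ r →
      ‖∫ x in Ω, fderiv ℝ F x d‖ₑ ≤ C * eLpNorm F (ENNReal.ofReal p) (surfaceMeasure Ω) := by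
  have hd0 : d ≠ 0 := by
    rintro rfl
    have := hC.increasing 0 hd 0 1 zero_le_one
    simp at this
    linarith
  have hdn : 0 < ‖d‖ := norm_pos_iff.2 hd0
  set d₁ := ‖d‖⁻¹ • d with hd₁
  have hd₁' : ‖d₁‖ = 1 := norm_smul_inv_norm hd0
  have hdd : d = ‖d‖ • d₁ := by rw [hd₁, smul_smul, mul_inv_cancel₀ hdn.ne', one_smul]
  obtain ⟨Φ, P, hΦm, hP, hPΦ, hΦt⟩ := exists_directional_coordinates hd₁'
  set T : Set (Fin m → ℝ) := Metric.closedBall (P x₀) r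
  refine ⟨‖d‖ₑ * volume T ^ (1 / (1 : ℝ≥0∞).toReal - 1 / (ENNReal.ofReal p).toReal), ?_, ?_⟩
  · refine ENNReal.mul_ne_top enorm_ne_top (ENNReal.rpow_ne_top_of_nonneg ?_
      measure_closedBall_lt_top.ne)
    rw [ENNReal.toReal_ofReal (by linarith), ENNReal.toReal_one, div_one, sub_nonneg]
    exact div_le_one_of_le₀ hp (by linarith)
  intro F hF hF'
  have hcs : HasCompactSupport F :=
    (isCompact_closedBall x₀ r).of_isClosed_subset (isClosed_tsupport _)
      (hF'.trans Metric.ball_subset_closedBall)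
  set H : E (m + 1) → ℝ := Ω.indicator (fun x => fderiv ℝ F x d₁) with hH
  have hHc : Continuous fun x => fderiv ℝ F x d₁ :=
    (hF.continuous_fderiv one_ne_zero).clm_apply continuous_const
  have hHi : Integrable H :=
    (hHc.integrable_of_hasCompactSupport
      (hcs.fderiv ℝ |>.comp_left (g := fun L : E (m + 1) →L[ℝ] ℝ => L d₁) rfl)).indicator
      hΩ.measurableSet
  have hHm : StronglyMeasurable H := hHc.stronglyMeasurable.indicator hΩ.measurableSet
  set f : (Fin m → ℝ) → ℝ := fun y => ∫ t : ℝ, H (Φ (t, y)) with hf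
  have hfm : StronglyMeasurable f := by
    have : StronglyMeasurable fun z : (Fin m → ℝ) × ℝ => H (Φ (z.2, z.1)) :=
      hHm.comp_measurable (Φ.measurable.comp measurable_swap)
    exact this.integral_prod_right
  have hfz : ∀ y, f y = ∫ t : ℝ, H (Φ (0, y) + t • d₁) := by
    intro y; simp only [hf]; congr 1 with t; rw [hΦt]
  have hfiber : ∀ y, f y ≠ 0 → ∃ x ∈ frontier Ω, P x = y ∧ |f y| = |F x| := by
    intro y hy
    rw [hfz] at hy ⊢
    obtain ⟨t, ht, ht'⟩ := hC.exists_frontier_line_integral_eq hΩ hd (inv_pos.2 hdn) hd₁ hd₁'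
      hF hF' _ hy
    refine ⟨_, ht, ?_, ?_⟩
    · rw [← hΦt, hPΦ]
    · rw [ht', abs_neg]
  have hfT : ∀ y, y ∉ T → f y = 0 := by
    intro y hy
    by_contra h
    obtain ⟨x, -, hxy, hx⟩ := hfiber y h
    have hx0 : F x ≠ 0 := by
      rw [← abs_pos, ← hx, abs_pos]; exact h
    have h1 := hF' (subset_tsupport _ hx0)
    refine hy ?_
    rw [← hxy]
    have h2 := hP.dist_le_mul x x₀
    rw [NNReal.coe_one, one_mul] at h2
    exact h2.trans (Metric.mem_ball.1 h1).le
  have hint : ∫ x in Ω, fderiv ℝ F x d = ‖d‖ * ∫ y, f y := by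
    have h1 : ∀ x, fderiv ℝ F x d = ‖d‖ * fderiv ℝ F x d₁ := by
      intro x
      conv_lhs => rw [hdd, map_smul, smul_eq_mul]
    simp only [h1]
    rw [integral_const_mul, ← integral_indicator hΩ.measurableSet,
      ← hΦm.integral_comp Φ.measurableEmbedding, Measure.volume_eq_prod, integral_prod_symm]
    rw [← Measure.volume_eq_prod]
    exact hΦm.integrable_comp_of_integrable hHi
  have hp0 : 0 < p := by linarith
  have hnorm : eLpNorm f (ENNReal.ofReal p) volume
      ≤ eLpNorm F (ENNReal.ofReal p) (surfaceMeasure Ω) := by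
    have hpn : ENNReal.ofReal p ≠ 0 := by simpa using hp0
    rw [eLpNorm_eq_lintegral_rpow_enorm_toReal hpn ENNReal.ofReal_ne_top,
      eLpNorm_eq_lintegral_rpow_enorm_toReal hpn ENNReal.ofReal_ne_top,
      ENNReal.toReal_ofReal hp0.le]
    have h1 : ∀ s : ℝ, ‖s‖ₑ ^ p = ENNReal.ofReal (|s| ^ p) := by
      intro s
      rw [← ENNReal.ofReal_rpow_of_nonneg (abs_nonneg _) hp0.le, ← Real.norm_eq_abs,
        ofReal_norm]
    simp only [h1]
    refine ENNReal.rpow_le_rpow ?_ (by positivity)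
    have h2 := lintegral_le_of_le_on_fiber hP (frontier Ω) (h := fun x => |F x| ^ p)
      (by have := hF.continuous.measurable; fun_prop) (fun _ => by positivity)
      (f := fun y => |f y| ^ p) (by have := hfm.measurable; fun_prop) (fun _ => by positivity) ?_
    · refine h2.trans (le_of_eq ?_)
      rw [surfaceMeasure]
      congr 3
      push_cast; ring
    · intro y hy
      have : f y ≠ 0 := by
        intro h; apply hy; simp [h, hp0.ne']
      obtain ⟨x, hx, hxy, hle⟩ := hfiber y this
      exact ⟨x, hx, hxy, by rw [hle]⟩
  calc ‖∫ x in Ω, fderiv ℝ F x d‖ₑ = ‖d‖ₑ * ‖∫ y, f y‖ₑ := by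
        rw [hint, enorm_mul, enorm_norm]
    _ ≤ ‖d‖ₑ * ∫⁻ y, ‖f y‖ₑ := by gcongr; exact enorm_integral_le_lintegral_enorm _
    _ = ‖d‖ₑ * eLpNorm f 1 (volume.restrict T) := by
        rw [eLpNorm_one_eq_lintegral_enorm, setLIntegral_eq_of_support_subset]
        intro y hy
        by_contra h
        exact hy (by simp [hfT y h])
    _ ≤ ‖d‖ₑ * (eLpNorm f (ENNReal.ofReal p) (volume.restrict T) *
          volume T ^ (1 / (1 : ℝ≥0∞).toReal - 1 / (ENNReal.ofReal p).toReal)) := by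
        gcongr
        have := eLpNorm_le_eLpNorm_mul_rpow_measure_univ (μ := volume.restrict T)
          (show (1 : ℝ≥0∞) ≤ ENNReal.ofReal p by simpa using hp) hfm.aestronglyMeasurable
        rwa [Measure.restrict_apply_univ] at this
    _ ≤ _ := by
        rw [mul_right_comm, mul_assoc]
        gcongr
        exact (eLpNorm_restrict_le _ _ _ _).trans hnorm

theorem tendsto_zero_of_enorm_le {F : Type*} [NormedAddCommGroup F] {f : ℕ → F} {b : ℕ → ℝ≥0∞}
    {C : ℝ≥0∞} (hC : C ≠ ⊤) (hb : Tendsto b atTop (𝓝 0)) (h : ∀ k, ‖f k‖ₑ ≤ C * b k) :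
    Tendsto f atTop (𝓝 0) := by
  rw [tendsto_zero_iff_enorm_tendsto_zero]
  have h1 := ENNReal.Tendsto.const_mul hb (Or.inr hC)
  rw [mul_zero] at h1
  exact tendsto_of_tendsto_of_tendsto_of_le_of_le tendsto_const_nhds h1 (fun _ => zero_le) h

theorem tendsto_eLpNorm_zero_of_le {α F F' : Type*} {_ : MeasurableSpace α}
    [NormedAddCommGroup F] [NormedAddCommGroup F'] {μ : Measure α} {p : ℝ≥0∞}
    {f : ℕ → α → F} {g : ℕ → α → F'} {C : ℝ}
    (hg : Tendsto (fun k => eLpNorm (g k) p μ) atTop (𝓝 0))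
    (h : ∀ k, ∀ᵐ x ∂μ, ‖f k x‖ ≤ C * ‖g k x‖) :
    Tendsto (fun k => eLpNorm (f k) p μ) atTop (𝓝 0) := by
  have h1 := ENNReal.Tendsto.const_mul hg (Or.inr (ENNReal.ofReal_ne_top (r := C)))
  rw [mul_zero] at h1
  exact tendsto_of_tendsto_of_tendsto_of_le_of_le tendsto_const_nhds h1 (fun _ => zero_le)
    fun k => eLpNorm_le_mul_eLpNorm_of_ae_le_mul (h k) p

theorem integrable_fderiv_apply {n : ℕ} {F : E n → ℝ} (hF : ContDiff ℝ 1 F)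
    (hcs : HasCompactSupport F) (d : E n) : Integrable (fun x => fderiv ℝ F x d) :=
  ((hF.continuous_fderiv one_ne_zero).clm_apply continuous_const).integrable_of_hasCompactSupport
      (hcs.fderiv ℝ |>.comp_left (g := fun L : E n →L[ℝ] ℝ => L d) rfl)

theorem IsConeChart.tendsto_integral_fderiv {m : ℕ} {Ω : Set (E (m + 1))} {x₀ e : E (m + 1)}
    {G : E (m + 1) → ℝ} {r δ : ℝ} (hC : IsConeChart Ω x₀ e G r δ) (hΩ : IsOpen Ω)
    {p : ℝ} (hp : 1 ≤ p) {F : ℕ → E (m + 1) → ℝ} (hF : ∀ k, ContDiff ℝ 1 (F k))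
    (hF' : ∀ k, tsupport (F k) ⊆ Metric.ball x₀ r)
    (h : Tendsto (fun k => eLpNorm (F k) (ENNReal.ofReal p) (surfaceMeasure Ω)) atTop (𝓝 0))
    (d : E (m + 1)) :
    Tendsto (fun k => ∫ x in Ω, fderiv ℝ (F k) x d) atTop (𝓝 0) := by
  have hcone : ∀ d ∈ Metric.ball e δ,
      Tendsto (fun k => ∫ x in Ω, fderiv ℝ (F k) x d) atTop (𝓝 0) := by
    intro d hd
    obtain ⟨C, hC, hle⟩ := hC.enorm_integral_fderiv_le hΩ hd hp
    exact tendsto_zero_of_enorm_le hC h fun k => hle _ (hF k) (hF' k)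
  -- the cone is open, hence `τ d` is a difference of two of its directions for small `τ`
  obtain ⟨τ, hτ, hτd⟩ : ∃ τ : ℝ, 0 < τ ∧ e + τ • d ∈ Metric.ball e δ := by
    have : Tendsto (fun τ : ℝ => e + τ • d) (𝓝[>] 0) (𝓝 e) := by
      have h1 : Continuous fun τ : ℝ => e + τ • d := by fun_prop
      simpa using (h1.tendsto 0).mono_left nhdsWithin_le_nhds
    obtain ⟨τ, h1, h2⟩ := ((this.eventually (Metric.ball_mem_nhds e hC.δ_pos)).and
      self_mem_nhdsWithin).exists
    exact ⟨τ, h2, h1⟩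
  have h1 := ((hcone _ hτd).sub (hcone e (Metric.mem_ball_self hC.δ_pos))).const_mul τ⁻¹
  rw [sub_zero, mul_zero] at h1
  refine h1.congr fun k => ?_
  have hcs : HasCompactSupport (F k) :=
    (isCompact_closedBall x₀ r).of_isClosed_subset (isClosed_tsupport _)
      ((hF' k).trans Metric.ball_subset_closedBall)
  rw [← integral_sub (integrable_fderiv_apply (hF k) hcs _).integrableOn
    (integrable_fderiv_apply (hF k) hcs _).integrableOn, ← integral_const_mul]
  congr 1 with x
  rw [map_add, map_smul, smul_eq_mul, add_sub_cancel_left, inv_mul_cancel_left₀ hτ.ne']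

/-- A weak form of the Gauss-Green formula, which suffices to integrate by parts with functions
whose boundary values tend to zero. -/
theorem IsBoundedLipschitzDomain.tendsto_integral_fderiv {n : ℕ} [NeZero n] {Ω : Set (E n)}
    (hΩ : IsBoundedLipschitzDomain Ω) {p : ℝ} (hp : 1 ≤ p) {F : ℕ → E n → ℝ}
    (hF : ∀ k, ContDiff ℝ 1 (F k))
    (h : Tendsto (fun k => eLpNorm (F k) (ENNReal.ofReal p) (surfaceMeasure Ω)) atTop (𝓝 0))
    (d : E n) :
    Tendsto (fun k => ∫ x in Ω, fderiv ℝ (F k) x d) atTop (𝓝 0) := by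
  obtain ⟨m, rfl⟩ := Nat.exists_eq_succ_of_ne_zero (NeZero.ne n)
  choose e G r δ hC using fun x => hΩ.exists_isConeChart x
  obtain ⟨t, η, hη, hsum⟩ := exists_finite_smooth_partition hΩ.isBounded r
    (fun x => (hC x).r_pos)
  have hηF : ∀ i ∈ t, ∀ k, ContDiff ℝ 1 (fun x => η i x * F k x) := fun i hi k =>
    ((hη i hi).1.of_le (by simp)).mul (hF k)
  have h1 : ∀ i ∈ t, Tendsto (fun k => ∫ x in Ω, fderiv ℝ (fun x => η i x * F k x) x d)
      atTop (𝓝 0) := by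
    intro i hi
    obtain ⟨M, hM⟩ := (hη i hi).2.1.exists_bound_of_continuous (hη i hi).1.continuous
    refine (hC i).tendsto_integral_fderiv hΩ.isOpen hp (hηF i hi)
      (fun k => tsupport_mul_subset_left.trans (hη i hi).2.2)
      (tendsto_eLpNorm_zero_of_le (C := M) h fun k => ae_of_all _ fun x => ?_) d
    rw [norm_mul]
    gcongr
    exact hM x
  have h2 := tendsto_finsetSum t h1
  rw [Finset.sum_const_zero] at h2
  refine h2.congr fun k => ?_
  rw [← integral_finsetSum _ fun i hi =>
    (integrable_fderiv_apply (hηF i hi k) (hη i hi).2.1.mul_right d).integrableOn]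
  refine setIntegral_congr_fun hΩ.isOpen.measurableSet fun x hx => ?_
  have h3 : F k =ᶠ[𝓝 x] fun x => ∑ i ∈ t, η i x * F k x := by
    filter_upwards [hΩ.isOpen.mem_nhds hx] with y hy
    rw [← Finset.sum_mul, hsum y (subset_closure hy), one_mul]
  rw [h3.fderiv_eq, fderiv_fun_sum fun i hi => (hηF i hi k).differentiable one_ne_zero x,
    sum_apply]

/-! ### Weak gradient of the positive part -/

theorem tendsto_integral_mul_of_tendsto_L1 {α : Type*} {_ : MeasurableSpace α} {μ : Measure α}
    {c f : ℕ → α → ℝ} {c' f' : α → ℝ} {M : ℝ} (hc : ∀ k, AEStronglyMeasurable (c k) μ)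
    (hM : ∀ k x, ‖c k x‖ ≤ M) (hcc : ∀ᵐ x ∂μ, Tendsto (fun k => c k x) atTop (𝓝 (c' x)))
    (hf : ∀ k, Integrable (f k) μ) (hf' : Integrable f' μ)
    (hff : Tendsto (fun k => eLpNorm (fun x => f k x - f' x) 1 μ) atTop (𝓝 0)) :
    Tendsto (fun k => ∫ x, c k x * f k x ∂μ) atTop (𝓝 (∫ x, c' x * f' x ∂μ)) := by
  have h1 : Tendsto (fun k => ∫ x, c k x * f' x ∂μ) atTop (𝓝 (∫ x, c' x * f' x ∂μ)) := by
    refine tendsto_integral_of_dominated_convergence (fun x => M * ‖f' x‖)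
      (fun k => (hc k).mul hf'.1) (hf'.norm.const_mul M) (fun k => ae_of_all _ fun x => ?_) ?_
    · rw [norm_mul]; gcongr; exact hM k x
    · filter_upwards [hcc] with x hx using hx.mul_const _
  have h2 : Tendsto (fun k => ∫ x, c k x * (f k x - f' x) ∂μ) atTop (𝓝 0) := by
    refine tendsto_zero_of_enorm_le (ENNReal.ofReal_ne_top (r := M)) hff fun k => ?_
    refine (enorm_integral_le_lintegral_enorm _).trans ?_
    rw [← eLpNorm_one_eq_lintegral_enorm]
    refine eLpNorm_le_mul_eLpNorm_of_ae_le_mul (ae_of_all _ fun x => ?_) 1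
    rw [norm_mul]; gcongr; exact hM k x
  have h3 := h1.add h2
  rw [add_zero] at h3
  refine h3.congr fun k => ?_
  have h4 : Integrable (fun x => c k x * (f k x - f' x)) μ :=
    ((hf k).sub hf').bdd_mul (hc k) (ae_of_all _ (hM k))
  rw [← integral_add (hf'.bdd_mul (hc k) (ae_of_all _ (hM k))) h4]
  congr 1 with x
  ring

theorem gradient_apply_eq_fderiv {n : ℕ} (f : E n → ℝ) (x : E n) (i : Fin n) :
    gradient f x i = fderiv ℝ f x (EuclideanSpace.single i 1) := by
  rw [← inner_gradient_left, EuclideanSpace.inner_single_right]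
  simp

/-- A primitive of `s ↦ max 0 (min 1 (m s))`: a `C¹` approximation of the positive part. -/
def smoothPosPart (m : ℕ) (s : ℝ) : ℝ := ∫ t in (0 : ℝ)..s, max 0 (min 1 (m * t))

theorem hasDerivAt_smoothPosPart (m : ℕ) (s : ℝ) :
    HasDerivAt (smoothPosPart m) (max 0 (min 1 (m * s))) s := by
  have hc : Continuous fun t : ℝ => max 0 (min 1 ((m : ℝ) * t)) := by fun_prop
  exact intervalIntegral.integral_hasDerivAt_right (hc.intervalIntegrable _ _)
    (hc.stronglyMeasurableAtFilter _ _) hc.continuousAt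

theorem deriv_smoothPosPart_mem (m : ℕ) (s : ℝ) : |max 0 (min 1 ((m : ℝ) * s))| ≤ 1 := by
  rw [abs_of_nonneg (le_max_left _ _)]
  exact max_le zero_le_one (min_le_left _ _)

theorem contDiff_smoothPosPart (m : ℕ) : ContDiff ℝ 1 (smoothPosPart m) := by
  rw [contDiff_one_iff_deriv]
  refine ⟨fun s => (hasDerivAt_smoothPosPart m s).differentiableAt, ?_⟩
  rw [funext fun s => (hasDerivAt_smoothPosPart m s).deriv]
  fun_prop

theorem abs_smoothPosPart_sub_le (m : ℕ) (s t : ℝ) :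
    |smoothPosPart m s - smoothPosPart m t| ≤ |s - t| := by
  have := convex_univ.norm_image_sub_le_of_norm_hasDerivWithin_le (x := t) (y := s) (C := 1)
    (fun x _ => (hasDerivAt_smoothPosPart m x).hasDerivWithinAt)
    (fun x _ => deriv_smoothPosPart_mem m x) (mem_univ _) (mem_univ _)
  simpa using this

theorem smoothPosPart_zero (m : ℕ) : smoothPosPart m 0 = 0 := intervalIntegral.integral_same

theorem smoothPosPart_of_nonpos (m : ℕ) {s : ℝ} (hs : s ≤ 0) : smoothPosPart m s = 0 := by
  rw [smoothPosPart, intervalIntegral.integral_congr (g := fun _ => 0),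
    intervalIntegral.integral_zero]
  intro t ht
  rw [uIcc_of_ge hs] at ht
  exact max_eq_left ((min_le_right _ _).trans
    (mul_nonpos_of_nonneg_of_nonpos (by positivity) ht.2))

theorem abs_smoothPosPart_le (m : ℕ) (s : ℝ) : |smoothPosPart m s| ≤ |s| := by
  simpa [smoothPosPart_zero] using abs_smoothPosPart_sub_le m s 0

/-- For `g ≤ 0` the boundary values `β(s)` are controlled by the distance of `s` to `g`. -/
theorem abs_smoothPosPart_le_of_nonpos (m : ℕ) (s : ℝ) {g : ℝ} (hg : g ≤ 0) :
    |smoothPosPart m s| ≤ |s - g| := by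
  rcases le_total s 0 with hs | hs
  · simp [smoothPosPart_of_nonpos m hs]
  · refine (abs_smoothPosPart_le m s).trans ?_
    rw [abs_of_nonneg hs, abs_of_nonneg (by linarith)]
    linarith

theorem tendsto_deriv_smoothPosPart (s : ℝ) :
    Tendsto (fun m : ℕ => max 0 (min 1 ((m : ℝ) * s))) atTop (𝓝 (if 0 < s then 1 else 0)) := by
  split_ifs with hs
  · refine tendsto_const_nhds.congr' ?_
    filter_upwards [tendsto_natCast_atTop_atTop.eventually_ge_atTop (1 / s)] with m hm
    have : 1 ≤ m * s := by rwa [div_le_iff₀ hs] at hm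
    rw [min_eq_left this, max_eq_right zero_le_one]
  · refine tendsto_const_nhds.congr fun m => ?_
    exact (max_eq_left ((min_le_right _ _).trans
      (mul_nonpos_of_nonneg_of_nonpos (by positivity) (not_lt.1 hs)))).symm

theorem tendsto_smoothPosPart (s : ℝ) :
    Tendsto (fun m => smoothPosPart m s) atTop (𝓝 (max s 0)) := by
  have h1 : Tendsto (fun m => smoothPosPart m s) atTop
      (𝓝 (∫ t in (0 : ℝ)..s, if 0 < t then (1 : ℝ) else 0)) := by
    refine intervalIntegral.tendsto_integral_filter_of_dominated_convergence (fun _ => 1)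
      (Eventually.of_forall fun m => ?_)
      (Eventually.of_forall fun m => ae_of_all _ fun t _ => deriv_smoothPosPart_mem m t)
      intervalIntegrable_const (ae_of_all _ fun t _ => tendsto_deriv_smoothPosPart t)
    exact Continuous.aestronglyMeasurable (by fun_prop)
  convert! h1 using 2
  rcases le_total s 0 with hs | hs
  · rw [max_eq_right hs, intervalIntegral.integral_congr (g := fun _ => 0),
      intervalIntegral.integral_zero]
    intro t ht
    rw [uIcc_of_ge hs] at ht
    exact if_neg (not_lt.2 ht.2)
  · rw [max_eq_left hs, intervalIntegral.integral_of_le hs,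
      setIntegral_congr_fun (g := fun _ => (1 : ℝ)) measurableSet_Ioc
        (fun t ht => if_pos ht.1)]
    simp [hs]

/-- The differentiable functions `φ k` converge to `w`, and their gradients to `H`, in `L^p(Ω)`. -/
def GradTendsto {n : ℕ} (Ω : Set (E n)) (p : ℝ) (φ : ℕ → E n → ℝ) (w : E n → ℝ)
    (H : E n → E n) : Prop :=
  Tendsto (fun k => eLpNorm (fun x => φ k x - w x) (ENNReal.ofReal p) (volume.restrict Ω))
      atTop (𝓝 0) ∧
    Tendsto (fun k => eLpNorm (fun x => gradient (φ k) x - H x)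
      (ENNReal.ofReal p) (volume.restrict Ω)) atTop (𝓝 0)

theorem tendsto_eLpNorm_one {α F : Type*} {_ : MeasurableSpace α} [NormedAddCommGroup F]
    {μ : Measure α} [IsFiniteMeasure μ] {p : ℝ≥0∞} (hp : 1 ≤ p) {f : ℕ → α → F}
    (hf : ∀ k, AEStronglyMeasurable (f k) μ)
    (h : Tendsto (fun k => eLpNorm (f k) p μ) atTop (𝓝 0)) :
    Tendsto (fun k => eLpNorm (f k) 1 μ) atTop (𝓝 0) := by
  have hne : μ univ ^ (1 / (1 : ℝ≥0∞).toReal - 1 / p.toReal) ≠ ⊤ := by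
    refine ENNReal.rpow_ne_top_of_nonneg ?_ (measure_ne_top _ _)
    rcases eq_or_ne p ⊤ with rfl | hp'
    · simp
    · have h1 : (1 : ℝ) ≤ p.toReal := by
        simpa using ENNReal.toReal_mono hp' hp
      simpa using inv_le_one_of_one_le₀ h1
  have h1 := ENNReal.Tendsto.mul_const h (Or.inr hne)
  rw [zero_mul] at h1
  exact tendsto_of_tendsto_of_tendsto_of_le_of_le tendsto_const_nhds h1 (fun _ => zero_le)
    fun k => eLpNorm_le_eLpNorm_mul_rpow_measure_univ hp (hf k)

theorem continuous_gradient_of_contDiff {n : ℕ} {φ : E n → ℝ} (hφ : ContDiff ℝ 1 φ) :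
    Continuous (gradient φ) :=
  (InnerProductSpace.toDual ℝ (E n)).symm.continuous.comp (hφ.continuous_fderiv one_ne_zero)

theorem integrableOn_of_continuous {n : ℕ} {F : Type*} [NormedAddCommGroup F]
    {Ω : Set (E n)} (hΩ : Bornology.IsBounded Ω) {f : E n → F} (hf : Continuous f) :
    IntegrableOn f Ω :=
  (hf.continuousOn.integrableOn_compact hΩ.isCompact_closure).mono_set subset_closure

theorem IsBoundedLipschitzDomain.isFiniteMeasure {n : ℕ} {Ω : Set (E n)}
    (hΩ : IsBoundedLipschitzDomain Ω) : IsFiniteMeasure (volume.restrict Ω) :=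
  ⟨by rw [Measure.restrict_apply_univ]; exact hΩ.isBounded.measure_lt_top⟩

/-- The chain rule for `β(w)`, tested with functions that need not vanish on `∂Ω`: since `w ≤ 0` on
the boundary, `β(w)` vanishes there. -/
theorem integral_smoothPosPart_mul_fderiv {n : ℕ} [NeZero n] {Ω : Set (E n)}
    (hΩ : IsBoundedLipschitzDomain Ω) {p : ℝ} (hp : 1 ≤ p) {w g : E n → ℝ} {H : E n → E n}
    {φ : ℕ → E n → ℝ} (hφ : ∀ k, ContDiff ℝ ∞ (φ k))
    (hw : MemLp w (ENNReal.ofReal p) (volume.restrict Ω))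
    (hH : MemLp H (ENNReal.ofReal p) (volume.restrict Ω)) (hlim : GradTendsto Ω p φ w H)
    (hg : g ≤ᵐ[surfaceMeasure Ω] 0)
    (hbd : Tendsto (fun k => eLpNorm (fun x => φ k x - g x) (ENNReal.ofReal p)
      (surfaceMeasure Ω)) atTop (𝓝 0))
    {ψ : E n → ℝ} (hψ : ContDiff ℝ ∞ ψ) (hψc : HasCompactSupport ψ) (d : E n) (m : ℕ) :
    (∫ x in Ω, fderiv ℝ ψ x d * smoothPosPart m (w x)) +
      ∫ x in Ω, (max 0 (min 1 (m * w x)) * ψ x) * inner ℝ (H x) d = 0 := by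
  have := hΩ.isFiniteMeasure
  have hp1 : 1 ≤ ENNReal.ofReal p := by simpa using hp
  have hp0 : ENNReal.ofReal p ≠ 0 := (zero_lt_one.trans_le hp1).ne'
  have hφm : ∀ k, AEStronglyMeasurable (φ k) (volume.restrict Ω) :=
    fun k => (hφ k).continuous.aestronglyMeasurable
  obtain ⟨ns, hns, hae⟩ := (tendstoInMeasure_of_tendsto_eLpNorm hp0 hφm hw.1
    hlim.1).exists_seq_tendsto_ae
  have hnt := hns.tendsto_atTop
  have hφ1 : ∀ k, ContDiff ℝ 1 (φ k) := fun k => (hφ k).of_le (by simp)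
  have hψ1 : ContDiff ℝ 1 ψ := hψ.of_le (by simp)
  obtain ⟨M, hM⟩ := hψc.exists_bound_of_continuous hψ.continuous
  have hM0 : 0 ≤ M := (norm_nonneg _).trans (hM 0)
  have hψd : Continuous fun x => fderiv ℝ ψ x d :=
    (hψ1.continuous_fderiv one_ne_zero).clm_apply continuous_const
  obtain ⟨M', hM'⟩ := (hψc.fderiv ℝ |>.comp_left (g := fun L : E n →L[ℝ] ℝ => L d)
    rfl).exists_bound_of_continuous hψd
  have hβc : Continuous (smoothPosPart m) := (contDiff_smoothPosPart m).continuous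
  have hwi : Integrable w (volume.restrict Ω) := hw.integrable hp1
  have hHi : Integrable H (volume.restrict Ω) := hH.integrable hp1
  -- the products `β(φ k) ψ` tend to zero on the boundary
  have hF : ∀ k, ContDiff ℝ 1 (fun x => smoothPosPart m (φ k x) * ψ x) := fun k =>
    ((contDiff_smoothPosPart m).comp (hφ1 k)).mul hψ1
  have h0 := hΩ.tendsto_integral_fderiv hp (fun k => hF (ns k))
    (tendsto_eLpNorm_zero_of_le (C := M) (hbd.comp hnt) fun k => by
      filter_upwards [hg] with x hx
      rw [norm_mul, mul_comm]
      gcongr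
      · exact hM x
      · exact abs_smoothPosPart_le_of_nonpos m _ hx) d
  have h1 : Tendsto (fun k => ∫ x in Ω, fderiv ℝ ψ x d * smoothPosPart m (φ (ns k) x)) atTop
      (𝓝 (∫ x in Ω, fderiv ℝ ψ x d * smoothPosPart m (w x))) := by
    refine tendsto_integral_mul_of_tendsto_L1 (c := fun _ x => fderiv ℝ ψ x d)
      (fun _ => hψd.aestronglyMeasurable) (fun _ x => hM' x)
      (ae_of_all _ fun x => tendsto_const_nhds)
      (fun k => integrableOn_of_continuous hΩ.isBounded (hβc.comp (hφ _).continuous))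
      (hwi.norm.mono' (hβc.comp_aestronglyMeasurable hw.1)
        (ae_of_all _ fun x => abs_smoothPosPart_le m (w x))) ?_
    refine tendsto_eLpNorm_zero_of_le (C := 1)
      ((tendsto_eLpNorm_one hp1 (fun k => (hφm k).sub hw.1) hlim.1).comp hnt)
      fun k => ae_of_all _ fun x => ?_
    rw [one_mul]
    exact abs_smoothPosPart_sub_le m _ _
  have h2 : Tendsto (fun k => ∫ x in Ω, (max 0 (min 1 (m * φ (ns k) x)) * ψ x) *
      inner ℝ (gradient (φ (ns k)) x) d) atTop
      (𝓝 (∫ x in Ω, (max 0 (min 1 (m * w x)) * ψ x) * inner ℝ (H x) d)) := by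
    have hc : ∀ k, Continuous fun x => max 0 (min 1 (m * φ (ns k) x)) * ψ x := by
      intro k
      have := (hφ (ns k)).continuous
      have := hψ.continuous
      fun_prop
    refine tendsto_integral_mul_of_tendsto_L1 (M := M) (fun k => (hc k).aestronglyMeasurable)
      (fun k x => ?_) ?_ (fun k => integrableOn_of_continuous hΩ.isBounded
        ((continuous_gradient_of_contDiff (hφ1 _)).inner continuous_const)) (hHi.inner_const d) ?_
    · rw [norm_mul]
      calc _ ≤ 1 * M := by
            gcongr
            · exact deriv_smoothPosPart_mem m _
            · exact hM x
        _ = M := one_mul M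
    · filter_upwards [hae] with x hx
      have hc : Continuous fun s : ℝ => max 0 (min 1 (m * s)) * ψ x := by fun_prop
      exact (hc.tendsto (w x)).comp hx
    · refine tendsto_eLpNorm_zero_of_le (C := ‖d‖)
        ((tendsto_eLpNorm_one hp1 (fun k =>
          (continuous_gradient_of_contDiff (hφ1 k)).aestronglyMeasurable.sub hH.1) hlim.2).comp hnt)
        fun k => ae_of_all _ fun x => ?_
      rw [← inner_sub_left, mul_comm]
      exact norm_inner_le_norm _ _
  refine tendsto_nhds_unique (h1.add h2) (h0.congr fun k => ?_)
  rw [← integral_add]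
  · congr 1 with x
    have h3 := ((hasDerivAt_smoothPosPart m (φ (ns k) x)).comp_hasFDerivAt x
      ((hφ1 (ns k)).differentiable one_ne_zero x).hasFDerivAt).mul
      (hψ1.differentiable one_ne_zero x).hasFDerivAt
    have h4 := h3.fderiv
    simp only [Function.comp_def] at h4
    change fderiv ℝ (fun x => smoothPosPart m (φ (ns k) x) * ψ x) x = _ at h4
    rw [h4, inner_gradient_left]
    simp only [add_apply, smul_apply, smul_eq_mul]
    ring
  · refine integrableOn_of_continuous hΩ.isBounded (hψd.mul (hβc.comp (hφ _).continuous))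
  · have h5 := continuous_gradient_of_contDiff (hφ1 (ns k))
    have h6 := (hφ (ns k)).continuous
    have h7 := hψ.continuous
    exact integrableOn_of_continuous hΩ.isBounded (by fun_prop)

/-- If `w ≤ 0` on `∂Ω`, the extension of `w⁺` by zero has a weak gradient on the whole space, the
extension by zero of `1_{w > 0} ∇w`. -/
theorem isWeakGradient_univ_posPart {n : ℕ} [NeZero n] {Ω : Set (E n)}
    (hΩ : IsBoundedLipschitzDomain Ω) {p : ℝ} (hp : 1 ≤ p) {w g : E n → ℝ} {H : E n → E n}
    {φ : ℕ → E n → ℝ} (hφ : ∀ k, ContDiff ℝ ∞ (φ k))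
    (hw : MemLp w (ENNReal.ofReal p) (volume.restrict Ω))
    (hH : MemLp H (ENNReal.ofReal p) (volume.restrict Ω)) (hlim : GradTendsto Ω p φ w H)
    (hg : g ≤ᵐ[surfaceMeasure Ω] 0)
    (hbd : Tendsto (fun k => eLpNorm (fun x => φ k x - g x) (ENNReal.ofReal p)
      (surfaceMeasure Ω)) atTop (𝓝 0)) :
    IsWeakGradient univ (Ω.indicator fun x => max (w x) 0)
      (Ω.indicator fun x => if 0 < w x then H x else 0) := by
  have := hΩ.isFiniteMeasure
  have hp1 : 1 ≤ ENNReal.ofReal p := by simpa using hp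
  have hwi : Integrable w (volume.restrict Ω) := hw.integrable hp1
  have hHi : Integrable H (volume.restrict Ω) := hH.integrable hp1
  have hset : NullMeasurableSet {x | 0 < w x} (volume.restrict Ω) :=
    nullMeasurableSet_lt aemeasurable_const hw.1.aemeasurable
  have hWi : Integrable (fun x => max (w x) 0) (volume.restrict Ω) := hwi.pos_part
  have hKi : Integrable (fun x => if 0 < w x then H x else 0) (volume.restrict Ω) := by
    have : (fun x => if 0 < w x then H x else 0) = {x | 0 < w x}.indicator H := by
      ext1 x; simp [indicator_apply]
    rw [this]
    exact hHi.indicator₀ hset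
  refine ⟨?_, ?_, ?_⟩
  · rw [locallyIntegrableOn_univ]
    exact ((integrable_indicator_iff hΩ.isOpen.measurableSet).2 hWi).locallyIntegrable
  · rw [locallyIntegrableOn_univ]
    exact ((integrable_indicator_iff hΩ.isOpen.measurableSet).2 hKi).locallyIntegrable
  · rintro ψ ⟨hψ, hψc, -⟩ i
    set d : E n := EuclideanSpace.single i 1
    have hψ1 : ContDiff ℝ 1 ψ := hψ.of_le (by simp)
    obtain ⟨M, hM⟩ := hψc.exists_bound_of_continuous hψ.continuous
    have hψd : Continuous fun x => fderiv ℝ ψ x d :=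
      (hψ1.continuous_fderiv one_ne_zero).clm_apply continuous_const
    obtain ⟨M', hM'⟩ := (hψc.fderiv ℝ |>.comp_left (g := fun L : E n →L[ℝ] ℝ => L d)
      rfl).exists_bound_of_continuous hψd
    have h1 : Tendsto (fun m => ∫ x in Ω, fderiv ℝ ψ x d * smoothPosPart m (w x)) atTop
        (𝓝 (∫ x in Ω, fderiv ℝ ψ x d * max (w x) 0)) := by
      refine tendsto_integral_of_dominated_convergence (fun x => M' * ‖w x‖)
        (fun m => hψd.aestronglyMeasurable.mul
          ((contDiff_smoothPosPart m).continuous.comp_aestronglyMeasurable hw.1))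
        (hwi.norm.const_mul M') (fun m => ae_of_all _ fun x => ?_)
        (ae_of_all _ fun x => (tendsto_smoothPosPart (w x)).const_mul _)
      rw [norm_mul]
      exact mul_le_mul (hM' x) (abs_smoothPosPart_le m (w x)) (norm_nonneg _)
        ((norm_nonneg _).trans (hM' x))
    have h2 : Tendsto (fun m : ℕ => ∫ x in Ω, (max 0 (min 1 (m * w x)) * ψ x) * inner ℝ (H x) d)
        atTop (𝓝 (∫ x in Ω, ((if 0 < w x then 1 else 0) * ψ x) * inner ℝ (H x) d)) := by
      refine tendsto_integral_of_dominated_convergence (fun x => M * ‖inner ℝ (H x) d‖)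
        (fun m => ?_) ((hHi.inner_const d).norm.const_mul M) (fun m => ae_of_all _ fun x => ?_)
        (ae_of_all _ fun x => ((tendsto_deriv_smoothPosPart (w x)).mul_const _).mul_const _)
      · have hc : Continuous fun s : ℝ => max 0 (min 1 (m * s)) := by fun_prop
        exact ((hc.comp_aestronglyMeasurable hw.1).mul hψ.continuous.aestronglyMeasurable).mul
          (hHi.inner_const d).1
      · rw [norm_mul, norm_mul]
        gcongr
        calc _ ≤ 1 * M := by
              gcongr
              · exact deriv_smoothPosPart_mem m _
              · exact hM x
          _ = M := one_mul M
    have h3 := tendsto_nhds_unique (h1.add h2) (tendsto_const_nhds.congr fun m =>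
      (integral_smoothPosPart_mul_fderiv hΩ hp hφ hw hH hlim hg hbd hψ hψc d m).symm)
    rw [Measure.restrict_univ]
    calc _ = ∫ x in Ω, fderiv ℝ ψ x d * max (w x) 0 := by
          rw [← integral_indicator hΩ.isOpen.measurableSet]
          congr 1 with x
          rw [gradient_apply_eq_fderiv]
          by_cases hx : x ∈ Ω <;> simp [hx, d, mul_comm]
      _ = -∫ x in Ω, ((if 0 < w x then 1 else 0) * ψ x) * inner ℝ (H x) d := by linarith
      _ = _ := by
          rw [← integral_indicator hΩ.isOpen.measurableSet]
          congr 2 with x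
          by_cases hx : x ∈ Ω
          · by_cases hx' : 0 < w x
            · simp [hx, hx', d, EuclideanSpace.inner_single_right, mul_comm]
            · simp [hx, hx']
          · simp [hx]

/-! ### Mollification -/

/-- The convolution of `f` with the kernel `K`. -/
def mollify {n : ℕ} {F : Type*} [NormedAddCommGroup F] [NormedSpace ℝ F] (K : E n → ℝ)
    (f : E n → F) : E n → F :=
  convolution f K (ContinuousLinearMap.lsmul ℝ ℝ).flip volume

section Mollify

variable {n : ℕ} {F : Type*} [NormedAddCommGroup F] [NormedSpace ℝ F]

theorem mollify_apply (K : E n → ℝ) (f : E n → F) (x : E n) :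
    mollify K f x = ∫ y, K (x - y) • f y := rfl

theorem mollify_apply' (K : E n → ℝ) (f : E n → F) (x : E n) :
    mollify K f x = ∫ z, K z • f (x - z) := by
  rw [mollify, convolution_eq_swap]
  rfl

theorem integrable_mollify {K : E n → ℝ} (hK : Continuous K) (hKc : HasCompactSupport K)
    {f : E n → F} (hf : LocallyIntegrable f) (x : E n) :
    Integrable (fun y => K (x - y) • f y) :=
  hKc.convolutionExists_right (ContinuousLinearMap.lsmul ℝ ℝ).flip hf hK x

theorem integrable_mollify' {K : E n → ℝ} (hK : Continuous K) (hKc : HasCompactSupport K)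
    {f : E n → F} (hf : LocallyIntegrable f) (x : E n) :
    Integrable (fun z => K z • f (x - z)) := by
  simpa using (integrable_mollify hK hKc hf x).comp_sub_left x

theorem contDiff_mollify {K : E n → ℝ} (hK : ContDiff ℝ ∞ K) (hKc : HasCompactSupport K)
    {f : E n → F} (hf : LocallyIntegrable f) : ContDiff ℝ ∞ (mollify K f) :=
  hKc.contDiff_convolution_right _ hf hK

theorem exists_of_mollify_ne_zero {K : E n → ℝ} {f : E n → F} {x : E n}
    (h : mollify K f x ≠ 0) : ∃ z, K z ≠ 0 ∧ f (x - z) ≠ 0 := by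
  by_contra! hc
  refine h ?_
  rw [mollify_apply', ← integral_zero (E n) F]
  congr 1 with z
  by_cases hz : K z = 0
  · simp [hz]
  · simp [hc z hz]

/-- By Jensen's inequality, the `L^p` distance between `f` and an average of translates of `f` is
at most the largest distance between `f` and these translates. -/
theorem eLpNorm_mollify_sub_le [CompleteSpace F] {K : E n → ℝ} (hK : Continuous K)
    (hKc : HasCompactSupport K) (hK0 : ∀ z, 0 ≤ K z) (hK1 : ∫ z, K z = 1) {p : ℝ} (hp : 1 ≤ p)
    {f : E n → F} (hf : MemLp f (ENNReal.ofReal p) volume) {ε : ℝ≥0∞}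
    (h : ∀ z, K z ≠ 0 → eLpNorm (fun x => f (x - z) - f x) (ENNReal.ofReal p) volume ≤ ε) :
    eLpNorm (fun x => mollify K f x - f x) (ENNReal.ofReal p) volume ≤ ε := by
  have hp1 : 1 ≤ ENNReal.ofReal p := by simpa using hp
  have hp0 : 0 < p := by linarith
  have hpn : ENNReal.ofReal p ≠ 0 := by simpa using hp0
  have hfl : LocallyIntegrable f := hf.locallyIntegrable hp1
  have hKi : Integrable K := hK.integrable_of_hasCompactSupport hKc
  have hKm : Measurable fun z => ENNReal.ofReal (K z) := hK.measurable.ennreal_ofReal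
  set ν : Measure (E n) := volume.withDensity fun z => ENNReal.ofReal (K z) with hν
  have hν1 : IsProbabilityMeasure ν := by
    refine ⟨?_⟩
    rw [hν, withDensity_apply _ MeasurableSet.univ, Measure.restrict_univ,
      ← ofReal_integral_eq_lintegral_ofReal hKi (ae_of_all _ hK0), hK1, ENNReal.ofReal_one]
  have hac : ν ≪ volume := withDensity_absolutelyContinuous _ _
  have hm : ∀ x, AEStronglyMeasurable (fun z => f (x - z) - f x) volume := fun x =>
    (hf.1.comp_quasiMeasurePreserving
      (Measure.measurePreserving_sub_left volume x).quasiMeasurePreserving).sub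
      aestronglyMeasurable_const
  have hpt : ∀ x, ‖mollify K f x - f x‖ₑ ^ p ≤ ∫⁻ z, ‖f (x - z) - f x‖ₑ ^ p ∂ν := by
    intro x
    have h1 : mollify K f x - f x = ∫ z, K z • (f (x - z) - f x) := by
      simp only [smul_sub]
      rw [integral_sub (integrable_mollify' hK hKc hfl x) (hKi.smul_const _),
        integral_smul_const, hK1, one_smul, mollify_apply']
    have h2 : ‖mollify K f x - f x‖ₑ ≤ eLpNorm (fun z => f (x - z) - f x) 1 ν := by
      rw [h1, eLpNorm_one_eq_lintegral_enorm, hν,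
        lintegral_withDensity_eq_lintegral_mul₀' hKm.aemeasurable
          (((hm x).mono_ac hac).enorm)]
      refine (enorm_integral_le_lintegral_enorm _).trans (le_of_eq ?_)
      congr 1 with z
      rw [enorm_smul, Pi.mul_apply, Real.enorm_of_nonneg (hK0 z)]
    have h3 := h2.trans (eLpNorm_le_eLpNorm_of_exponent_le hp1 ((hm x).mono_ac hac))
    rw [eLpNorm_eq_lintegral_rpow_enorm_toReal hpn ENNReal.ofReal_ne_top,
      ENNReal.toReal_ofReal hp0.le] at h3
    have h4 := ENNReal.rpow_le_rpow h3 hp0.le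
    rwa [← ENNReal.rpow_mul, one_div_mul_cancel hp0.ne', ENNReal.rpow_one] at h4
  rw [eLpNorm_eq_lintegral_rpow_enorm_toReal hpn ENNReal.ofReal_ne_top,
    ENNReal.toReal_ofReal hp0.le, one_div, ENNReal.rpow_inv_le_iff hp0]
  calc ∫⁻ x, ‖mollify K f x - f x‖ₑ ^ p ≤ ∫⁻ x, ∫⁻ z, ‖f (x - z) - f x‖ₑ ^ p ∂ν :=
        lintegral_mono hpt
    _ = ∫⁻ z, (∫⁻ x, ‖f (x - z) - f x‖ₑ ^ p) ∂ν := by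
        refine lintegral_lintegral_swap ?_
        refine AEMeasurable.pow_const (AEStronglyMeasurable.enorm ?_) _
        exact (hf.1.comp_quasiMeasurePreserving
          (quasiMeasurePreserving_sub_of_right_invariant volume ν)).sub hf.1.comp_fst
    _ ≤ ∫⁻ _, ε ^ p ∂ν := by
        refine lintegral_mono_ae ?_
        have h5 : ∀ᵐ z ∂ν, ENNReal.ofReal (K z) ≠ 0 := by
          rw [hν, ae_withDensity_iff hKm]
          exact ae_of_all _ fun _ h => h
        filter_upwards [h5] with z hz
        have h6 := h z fun h0 => hz (by simp [h0])
        rwa [eLpNorm_eq_lintegral_rpow_enorm_toReal hpn ENNReal.ofReal_ne_top,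
          ENNReal.toReal_ofReal hp0.le, one_div, ENNReal.rpow_inv_le_iff hp0] at h6
    _ = ε ^ p := by simp

theorem tendsto_eLpNorm_translate_sub {F' : Type*} [NormedAddCommGroup F']
    {p : ℝ} (hp : 1 ≤ p) {f : E n → F'}
    (hf : MemLp f (ENNReal.ofReal p) volume) :
    Tendsto (fun z => eLpNorm (fun x => f (x - z) - f x) (ENNReal.ofReal p) volume) (𝓝 0)
      (𝓝 0) := by
  have : Fact (1 ≤ ENNReal.ofReal p) := ⟨by simpa using hp⟩
  have : Fact (ENNReal.ofReal p ≠ ⊤) := ⟨ENNReal.ofReal_ne_top⟩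
  have h1 : Continuous fun z : E n => DomAddAct.mk (-z) +ᵥ hf.toLp f :=
    (DomAddAct.continuous_mk.comp continuous_neg).vadd continuous_const
  have h2 := h1.tendsto 0
  simp only [DomAddAct.mk_vadd_toLp] at h2
  rw [Lp.tendsto_Lp_iff_tendsto_eLpNorm''] at h2
  refine h2.congr fun z => ?_
  congr 1 with x
  simp [neg_add_eq_sub]

theorem tendsto_eLpNorm_mollify_sub [CompleteSpace F] {K : ℕ → E n → ℝ}
    (hK : ∀ k, Continuous (K k)) (hKc : ∀ k, HasCompactSupport (K k)) (hK0 : ∀ k z, 0 ≤ K k z)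
    (hK1 : ∀ k, ∫ z, K k z = 1) {ρ : ℕ → ℝ} (hρ : Tendsto ρ atTop (𝓝 0))
    (hKρ : ∀ k z, K k z ≠ 0 → ‖z‖ ≤ ρ k) {p : ℝ} (hp : 1 ≤ p)
    {f : E n → F} (hf : MemLp f (ENNReal.ofReal p) volume) :
    Tendsto (fun k => eLpNorm (fun x => mollify (K k) f x - f x) (ENNReal.ofReal p) volume)
      atTop (𝓝 0) := by
  rw [ENNReal.tendsto_nhds_zero]
  intro ε hε
  obtain ⟨τ, hτ, h1⟩ := Metric.eventually_nhds_iff.1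
    (ENNReal.tendsto_nhds_zero.1 (tendsto_eLpNorm_translate_sub hp hf) ε hε)
  filter_upwards [hρ.eventually_lt_const hτ] with k hk
  refine eLpNorm_mollify_sub_le (hK k) (hKc k) (hK0 k) (hK1 k) hp hf fun z hz => h1 ?_
  rw [dist_zero_right]
  exact (hKρ k z hz).trans_lt hk

theorem gradient_mollify {K : E n → ℝ} (hK : ContDiff ℝ ∞ K) (hKc : HasCompactSupport K)
    {W : E n → ℝ} {H : E n → E n} (hW : IsWeakGradient univ W H) (x : E n) :
    gradient (mollify K W) x = mollify K H x := by
  have hWl : LocallyIntegrable W := locallyIntegrableOn_univ.1 hW.1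
  have hHl : LocallyIntegrable H := locallyIntegrableOn_univ.1 hW.2.1
  have hK1 : ContDiff ℝ 1 K := hK.of_le (by simp)
  ext i
  set d : E n := EuclideanSpace.single i 1 with hd
  have h1 := hKc.hasFDerivAt_convolution_right (ContinuousLinearMap.lsmul ℝ ℝ).flip hWl hK1 x
  have h2 : gradient (mollify K W) x i = ∫ y, fderiv ℝ K (x - y) d * W y := by
    rw [gradient_apply_eq_fderiv, ← hd, mollify, h1.fderiv,
      convolution_precompR_apply _ hWl (hKc.fderiv ℝ) (hK1.continuous_fderiv one_ne_zero)]
    rfl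
  have h3 : mollify K H x i = ∫ y, H y i * K (x - y) := by
    have h4 := (EuclideanSpace.proj i : E n →L[ℝ] ℝ).integral_comp_comm
      (integrable_mollify hK.continuous hKc hHl x)
    rw [mollify_apply]
    refine h4.symm.trans ?_
    congr 1 with y
    simp [mul_comm]
  have hψ : IsTestFunction univ fun y => K (x - y) := by
    refine ⟨hK.comp (by fun_prop), ?_, subset_univ _⟩
    exact hKc.comp_homeomorph (Homeomorph.subLeft x)
  have h5 := hW.2.2 _ hψ i
  rw [Measure.restrict_univ] at h5
  have h6 : ∀ y, gradient (fun y => K (x - y)) y i = -fderiv ℝ K (x - y) d := by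
    intro y
    rw [gradient_apply_eq_fderiv]
    have h7 : HasFDerivAt (fun y => K (x - y)) ((fderiv ℝ K (x - y)).comp
        (-ContinuousLinearMap.id ℝ (E n))) y :=
      (hK1.differentiable one_ne_zero (x - y)).hasFDerivAt.comp y
        ((hasFDerivAt_id y).const_sub x)
    rw [h7.fderiv]
    simp [hd]
  simp only [h6, mul_neg, integral_neg, neg_inj] at h5
  rw [h2, h3, ← h5]
  congr 1 with y
  rw [mul_comm]

end Mollify

/-- A smooth kernel of integral one supported in the ball of radius `ρ` about `c`. -/
theorem exists_kernel {n : ℕ} (c : E n) {ρ : ℝ} (hρ : 0 < ρ) :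
    ∃ K : E n → ℝ, ContDiff ℝ ∞ K ∧ HasCompactSupport K ∧ (∀ z, 0 ≤ K z) ∧ ∫ z, K z = 1 ∧
      ∀ z, K z ≠ 0 → z ∈ Metric.ball c ρ := by
  let b : ContDiffBump c := ⟨ρ / 2, ρ, by positivity, by linarith⟩
  refine ⟨b.normed volume, b.contDiff_normed, b.hasCompactSupport_normed, b.nonneg_normed,
    b.integral_normed, fun z hz => ?_⟩
  have : z ∈ Function.support (b.normed volume) := hz
  rwa [b.support_normed_eq] at this

/-! ### Functions with a weak gradient on the whole space, vanishing outside `Ω` -/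

theorem gradient_mul {n : ℕ} {f g : E n → ℝ} {x : E n} (hf : DifferentiableAt ℝ f x)
    (hg : DifferentiableAt ℝ g x) :
    gradient (fun x => f x * g x) x = f x • gradient g x + g x • gradient f x := by
  ext i
  simp only [PiLp.add_apply, PiLp.smul_apply, gradient_apply_eq_fderiv, smul_eq_mul]
  rw [fderiv_fun_mul hf hg]
  simp

theorem hasCompactSupport_gradient {n : ℕ} {f : E n → ℝ} (hf : HasCompactSupport f) :
    HasCompactSupport (gradient f) :=
  (hf.fderiv ℝ).comp_left (g := (InnerProductSpace.toDual ℝ (E n)).symm) (map_zero _)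

theorem memLp_smul_of_hasCompactSupport {n : ℕ} {F : Type*} [NormedAddCommGroup F]
    [NormedSpace ℝ F] {p : ℝ≥0∞} {η : E n → ℝ} (hη : Continuous η) (hηc : HasCompactSupport η)
    {f : E n → F} (hf : MemLp f p volume) : MemLp (fun x => η x • f x) p volume := by
  obtain ⟨M, hM⟩ := hηc.exists_bound_of_continuous hη
  refine (hf.const_smul M).mono (hη.aestronglyMeasurable.smul hf.1) (ae_of_all _ fun x => ?_)
  rw [Pi.smul_apply, norm_smul, norm_smul]
  gcongr
  exact (hM x).trans (le_abs_self M)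

theorem memLp_smul_vector_of_hasCompactSupport {n : ℕ} {p : ℝ≥0∞} {V : E n → E n}
    (hV : Continuous V) (hVc : HasCompactSupport V)
    {f : E n → ℝ} (hf : MemLp f p volume) : MemLp (fun x => f x • V x) p volume := by
  obtain ⟨M, hM⟩ := hVc.exists_bound_of_continuous hV
  refine (hf.const_smul M).mono (hf.1.smul hV.aestronglyMeasurable) (ae_of_all _ fun x => ?_)
  rw [Pi.smul_apply, norm_smul, norm_smul, mul_comm]
  gcongr
  exact (hM x).trans (le_abs_self M)

theorem IsWeakGradient.smooth_mul {n : ℕ} {W η : E n → ℝ} {H : E n → E n}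
    (hW : IsWeakGradient univ W H) (hη : ContDiff ℝ ∞ η) :
    IsWeakGradient univ (fun x => η x * W x) (fun x => η x • H x + W x • gradient η x) := by
  have hWl : LocallyIntegrable W := locallyIntegrableOn_univ.1 hW.1
  have hHl : LocallyIntegrable H := locallyIntegrableOn_univ.1 hW.2.1
  have hη1 : ContDiff ℝ 1 η := hη.of_le (by simp)
  have hgη := continuous_gradient_of_contDiff hη1
  refine ⟨?_, ?_, ?_⟩
  · exact hW.1.continuousOn_mul hη.continuous.continuousOn isOpen_univ.isLocallyClosed
  · exact (hW.2.1.continuousOn_smul isOpen_univ.isLocallyClosed hη.continuous.continuousOn).add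
      (hW.1.smul_continuousOn isOpen_univ.isLocallyClosed hgη.continuousOn)
  · rintro ψ ⟨hψ, hψc, -⟩ i
    have hψ1 : ContDiff ℝ 1 ψ := hψ.of_le (by simp)
    have hgψ := continuous_gradient_of_contDiff hψ1
    have h1 := hW.2.2 (fun x => η x * ψ x) ⟨hη.mul hψ, hψc.mul_left, subset_univ _⟩ i
    rw [Measure.restrict_univ] at h1 ⊢
    have hcomp : ∀ V : E n → E n, Continuous V → Continuous fun x => V x i := fun V hV =>
      (EuclideanSpace.proj i : E n →L[ℝ] ℝ).continuous.comp hV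
    have hi1 : Integrable fun x => (η x * gradient ψ x i) * W x := by
      have hc : HasCompactSupport fun x => gradient ψ x i :=
        (hasCompactSupport_gradient hψc).comp_left (g := fun v : E n => v i) rfl
      exact hWl.integrable_smul_left_of_hasCompactSupport
        (hη.continuous.mul (hcomp _ hgψ)) hc.mul_left
    have hi2 : Integrable fun x => (ψ x * gradient η x i) * W x :=
      hWl.integrable_smul_left_of_hasCompactSupport
        (hψ.continuous.mul (hcomp _ hgη)) hψc.mul_right
    have hi3 : Integrable fun x => (η x * ψ x) * H x i := by
      have := hHl.integrable_smul_left_of_hasCompactSupport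
        (hη.continuous.mul hψ.continuous) hψc.mul_left
      exact (EuclideanSpace.proj i : E n →L[ℝ] ℝ).integrable_comp this
    have h2 : ∫ x, W x * gradient (fun x => η x * ψ x) x i
        = (∫ x, (η x * gradient ψ x i) * W x) + ∫ x, (ψ x * gradient η x i) * W x := by
      rw [← integral_add hi1 hi2]
      congr 1 with x
      rw [gradient_mul (hη1.differentiable one_ne_zero x) (hψ1.differentiable one_ne_zero x)]
      simp only [PiLp.add_apply, PiLp.smul_apply, smul_eq_mul]
      ring
    have h3 : ∫ x, (η x • H x + W x • gradient η x) i * ψ x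
        = (∫ x, (η x * ψ x) * H x i) + ∫ x, (ψ x * gradient η x i) * W x := by
      rw [← integral_add hi3 hi2]
      congr 1 with x
      simp only [PiLp.add_apply, PiLp.smul_apply, smul_eq_mul]
      ring
    have h4 : ∫ x, η x * W x * gradient ψ x i = ∫ x, (η x * gradient ψ x i) * W x := by
      congr 1 with x; ring
    have h5 : ∫ x, H x i * (η x * ψ x) = ∫ x, (η x * ψ x) * H x i := by
      congr 1 with x; ring
    rw [h3, h4]
    rw [h2, h5] at h1
    linarith

/-- A function supported in a chart and vanishing outside `Ω` is a limit of test functions in `Ω`: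
mollify with kernels supported in the cone of the chart, which push the support into `Ω`. -/
theorem IsConeChart.exists_testFunction_tendsto {n : ℕ} {Ω : Set (E n)} {x₀ e : E n}
    {G : E n → ℝ} {r δ : ℝ} (hC : IsConeChart Ω x₀ e G r δ) {p : ℝ} (hp : 1 ≤ p)
    {U : E n → ℝ} {V : E n → E n} (hU : MemLp U (ENNReal.ofReal p) volume)
    (hV : MemLp V (ENNReal.ofReal p) volume) (hUV : IsWeakGradient univ U V)
    {S : Set (E n)} (hS : IsCompact S) (hSr : S ⊆ Metric.ball x₀ r)
    (hUS : ∀ x, U x ≠ 0 → x ∈ Ω ∩ S) :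
    ∃ φ : ℕ → E n → ℝ, (∀ k, IsTestFunction Ω (φ k)) ∧ GradTendsto Ω p φ U V := by
  have hp1 : 1 ≤ ENNReal.ofReal p := by simpa using hp
  obtain ⟨τ, hτ, hτS⟩ := hS.exists_cthickening_subset_open Metric.isOpen_ball hSr
  have hR : 0 < ‖e‖ + δ := add_pos_of_nonneg_of_pos (norm_nonneg _) hC.δ_pos
  set t : ℕ → ℝ := fun k => τ / (‖e‖ + δ) * (1 / (k + 1)) with ht
  have ht0 : ∀ k, 0 < t k := fun k => by positivity
  have htτ : ∀ k, t k * (‖e‖ + δ) ≤ τ := by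
    intro k
    have h1 : (1 : ℝ) / (k + 1) ≤ 1 := by
      rw [div_le_one (by positivity)]
      have : (0 : ℝ) ≤ k := by positivity
      linarith
    calc t k * (‖e‖ + δ) = τ * (1 / (k + 1)) := by simp only [ht]; field_simp
      _ ≤ τ * 1 := by gcongr
      _ = τ := mul_one τ
  have htlim : Tendsto (fun k => t k * (‖e‖ + δ)) atTop (𝓝 0) := by
    have := (tendsto_one_div_add_atTop_nhds_zero_nat (𝕜 := ℝ)).const_mul (τ / (‖e‖ + δ))
    simpa [ht] using this.mul_const (‖e‖ + δ)
  choose K hKs hKc hK0 hK1 hKb using fun k =>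
    exists_kernel (t k • e) (mul_pos (ht0 k) hC.δ_pos)
  -- the support of each kernel lies in the cone
  have hcone : ∀ k z, K k z ≠ 0 → ∃ d ∈ Metric.ball e δ, z = t k • d := by
    intro k z hz
    refine ⟨(t k)⁻¹ • z, ?_, by rw [smul_smul, mul_inv_cancel₀ (ht0 k).ne', one_smul]⟩
    have h1 := hKb k z hz
    have h2 : z - t k • e = t k • ((t k)⁻¹ • z - e) := by
      rw [smul_sub, smul_smul, mul_inv_cancel₀ (ht0 k).ne', one_smul]
    rw [mem_ball_iff_norm, h2, norm_smul, Real.norm_eq_abs, abs_of_pos (ht0 k)] at h1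
    rw [mem_ball_iff_norm]
    exact lt_of_mul_lt_mul_left h1 (ht0 k).le
  have hKn : ∀ k z, K k z ≠ 0 → ‖z‖ ≤ t k * (‖e‖ + δ) := by
    intro k z hz
    obtain ⟨d, hd, rfl⟩ := hcone k z hz
    rw [norm_smul, Real.norm_eq_abs, abs_of_pos (ht0 k)]
    have h1 := norm_le_norm_add_norm_sub' d e
    have h2 := (mem_ball_iff_norm.1 hd).le
    gcongr
    linarith
  have hUl : LocallyIntegrable U := hU.locallyIntegrable hp1
  refine ⟨fun k => mollify (K k) U, fun k => ⟨contDiff_mollify (hKs k) (hKc k) hUl, ?_⟩, ?_, ?_⟩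
  · set A : Set (E n) := {x | t k / 2 ≤ G x} ∩ Metric.cthickening τ S
    have hAc : IsCompact A :=
      hS.cthickening.inter_left (isClosed_le continuous_const hC.continuous)
    have hsub : tsupport (mollify (K k) U) ⊆ A := by
      refine closure_minimal (fun x hx => ?_) hAc.isClosed
      obtain ⟨z, hz, hz'⟩ := exists_of_mollify_ne_zero hx
      obtain ⟨hxΩ, hxS⟩ := hUS _ hz'
      have h1 := (hC.mem_iff _ (hSr hxS)).1 hxΩ
      have hzn := (hKn k z hz).trans (htτ k)
      obtain ⟨d, hd, rfl⟩ := hcone k z hz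
      have h2 := hC.increasing d hd (x - t k • d) (t k) (ht0 k).le
      rw [sub_add_cancel] at h2
      refine ⟨?_, Metric.mem_cthickening_of_dist_le x (x - t k • d) τ S hxS ?_⟩
      · change t k / 2 ≤ G x
        linarith
      · rwa [dist_eq_norm, sub_sub_cancel]
    refine ⟨hAc.of_isClosed_subset (isClosed_tsupport _) hsub, hsub.trans fun x hx => ?_⟩
    rw [hC.mem_iff x (hτS hx.2)]
    exact (half_pos (ht0 k)).trans_le hx.1
  · have h1 := tendsto_eLpNorm_mollify_sub (fun k => (hKs k).continuous) hKc hK0 hK1 htlim hKn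
      hp hU
    exact tendsto_of_tendsto_of_tendsto_of_le_of_le tendsto_const_nhds h1 (fun _ => zero_le)
      fun k => eLpNorm_restrict_le _ _ _ _
  · have h1 := tendsto_eLpNorm_mollify_sub (fun k => (hKs k).continuous) hKc hK0 hK1 htlim hKn
      hp hV
    simp only [gradient_mollify (hKs _) (hKc _) hUV]
    exact tendsto_of_tendsto_of_tendsto_of_le_of_le tendsto_const_nhds h1 (fun _ => zero_le)
      fun k => eLpNorm_restrict_le _ _ _ _

theorem GradTendsto.congr_right {n : ℕ} {Ω : Set (E n)} {p : ℝ} {φ : ℕ → E n → ℝ}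
    {w w' : E n → ℝ} {H H' : E n → E n} (h : GradTendsto Ω p φ w H)
    (hw : w =ᵐ[volume.restrict Ω] w') (hH : H =ᵐ[volume.restrict Ω] H') :
    GradTendsto Ω p φ w' H' := by
  refine ⟨h.1.congr fun k => eLpNorm_congr_ae ?_, h.2.congr fun k => eLpNorm_congr_ae ?_⟩
  · filter_upwards [hw] with x hx
    rw [hx]
  · filter_upwards [hH] with x hx
    rw [hx]

theorem GradTendsto.add {n : ℕ} {Ω : Set (E n)} {p : ℝ} (hp : 1 ≤ p) {φ φ' : ℕ → E n → ℝ}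
    {w w' : E n → ℝ} {H H' : E n → E n} (h : GradTendsto Ω p φ w H)
    (h' : GradTendsto Ω p φ' w' H') (hφ : ∀ k, ContDiff ℝ ∞ (φ k))
    (hφ' : ∀ k, ContDiff ℝ ∞ (φ' k)) (hw : AEStronglyMeasurable w (volume.restrict Ω))
    (hw' : AEStronglyMeasurable w' (volume.restrict Ω))
    (hH : AEStronglyMeasurable H (volume.restrict Ω))
    (hH' : AEStronglyMeasurable H' (volume.restrict Ω)) :
    GradTendsto Ω p (fun k x => φ k x + φ' k x) (fun x => w x + w' x) (fun x => H x + H' x) := by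
  have hp1 : 1 ≤ ENNReal.ofReal p := by simpa using hp
  have hφ1 : ∀ k, ContDiff ℝ 1 (φ k) := fun k => (hφ k).of_le (by simp)
  have hφ1' : ∀ k, ContDiff ℝ 1 (φ' k) := fun k => (hφ' k).of_le (by simp)
  constructor
  · have h1 := h.1.add h'.1
    rw [add_zero] at h1
    refine tendsto_of_tendsto_of_tendsto_of_le_of_le tendsto_const_nhds h1 (fun _ => zero_le)
      fun k => le_trans (le_of_eq ?_) (eLpNorm_add_le
        ((hφ k).continuous.aestronglyMeasurable.sub hw)
        ((hφ' k).continuous.aestronglyMeasurable.sub hw') hp1)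
    congr 1 with x
    simp only [Pi.add_apply]
    ring
  · have h1 := h.2.add h'.2
    rw [add_zero] at h1
    refine tendsto_of_tendsto_of_tendsto_of_le_of_le tendsto_const_nhds h1 (fun _ => zero_le)
      fun k => le_trans (le_of_eq ?_) (eLpNorm_add_le
        ((continuous_gradient_of_contDiff (hφ1 k)).aestronglyMeasurable.sub hH)
        ((continuous_gradient_of_contDiff (hφ1' k)).aestronglyMeasurable.sub hH') hp1)
    congr 1 with x
    have h2 : gradient (fun x => φ k x + φ' k x) x = gradient (φ k) x + gradient (φ' k) x := by
      simp only [gradient]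
      rw [fderiv_fun_add ((hφ1 k).differentiable one_ne_zero x)
        ((hφ1' k).differentiable one_ne_zero x), map_add]
    simp only [Pi.add_apply, h2]
    abel_nf

theorem GradTendsto.neg {n : ℕ} {Ω : Set (E n)} {p : ℝ} {φ : ℕ → E n → ℝ}
    {w : E n → ℝ} {H : E n → E n} (h : GradTendsto Ω p φ w H) :
    GradTendsto Ω p (fun k x => -φ k x) (fun x => -w x) (fun x => -H x) := by
  refine ⟨h.1.congr fun k => ?_, h.2.congr fun k => ?_⟩
  · rw [← eLpNorm_neg]
    congr 1 with x
    simp only [Pi.neg_apply]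
    ring
  · rw [← eLpNorm_neg]
    congr 1 with x
    have : gradient (fun x => -φ k x) x = -gradient (φ k) x := by
      simp only [gradient]
      rw [fderiv_fun_neg, map_neg]
    simp only [Pi.neg_apply, this]
    abel_nf

theorem GradTendsto.sum {n : ℕ} {ι : Type*} {Ω : Set (E n)} {p : ℝ} (hp : 1 ≤ p)
    {φ : ι → ℕ → E n → ℝ} {w : ι → E n → ℝ} {H : ι → E n → E n} (s : Finset ι)
    (h : ∀ i ∈ s, GradTendsto Ω p (φ i) (w i) (H i)) (hφ : ∀ i ∈ s, ∀ k, ContDiff ℝ ∞ (φ i k))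
    (hw : ∀ i ∈ s, AEStronglyMeasurable (w i) (volume.restrict Ω))
    (hH : ∀ i ∈ s, AEStronglyMeasurable (H i) (volume.restrict Ω)) :
    GradTendsto Ω p (fun k x => ∑ i ∈ s, φ i k x) (fun x => ∑ i ∈ s, w i x)
      (fun x => ∑ i ∈ s, H i x) := by
  classical
  induction s using Finset.induction_on with
  | empty => simp [GradTendsto, gradient]
  | insert a s ha ih =>
    simp only [Finset.sum_insert ha]
    simp only [Finset.forall_mem_insert] at h hφ hw hH
    exact h.1.add hp (ih h.2 hφ.2 hw.2 hH.2) hφ.1 (fun k => ContDiff.sum fun i hi => hφ.2 i hi k)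
      hw.1 (Finset.aestronglyMeasurable_fun_sum _ hw.2) hH.1
      (Finset.aestronglyMeasurable_fun_sum _ hH.2)

theorem IsTestFunction.sum {n : ℕ} {ι : Type*} {Ω : Set (E n)} {φ : ι → E n → ℝ} (s : Finset ι)
    (h : ∀ i ∈ s, IsTestFunction Ω (φ i)) : IsTestFunction Ω (fun x => ∑ i ∈ s, φ i x) := by
  classical
  induction s using Finset.induction_on with
  | empty =>
    simp only [Finset.sum_empty]
    exact ⟨contDiff_const, HasCompactSupport.zero, by simp⟩
  | insert a s ha ih =>
    simp only [Finset.sum_insert ha]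
    simp only [Finset.forall_mem_insert] at h
    obtain ⟨h1, h2, h3⟩ := ih h.2
    exact ⟨h.1.1.add h1, h.1.2.1.add h2, (tsupport_add _ _).trans (union_subset h.1.2.2 h3)⟩

/-- A function on a Lipschitz domain whose extension by zero lies in `W^{1,p}` of the whole space is
a limit of test functions. -/
theorem IsBoundedLipschitzDomain.exists_testFunction_tendsto {n : ℕ} [NeZero n] {Ω : Set (E n)}
    (hΩ : IsBoundedLipschitzDomain Ω) {p : ℝ} (hp : 1 ≤ p)
    {W : E n → ℝ} {H : E n → E n} (hW : MemLp W (ENNReal.ofReal p) volume)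
    (hH : MemLp H (ENNReal.ofReal p) volume) (hWH : IsWeakGradient univ W H)
    (hW0 : ∀ x ∉ Ω, W x = 0) :
    ∃ φ : ℕ → E n → ℝ, (∀ k, IsTestFunction Ω (φ k)) ∧ GradTendsto Ω p φ W H := by
  choose e G r δ hC using fun x => hΩ.exists_isConeChart x
  obtain ⟨t, η, hη, hsum⟩ := exists_finite_smooth_partition hΩ.isBounded r
    (fun x => (hC x).r_pos)
  have hη1 : ∀ i ∈ t, ContDiff ℝ 1 (η i) := fun i hi => (hη i hi).1.of_le (by simp)
  have hU : ∀ i ∈ t, MemLp (fun x => η i x * W x) (ENNReal.ofReal p) volume := fun i hi =>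
    memLp_smul_of_hasCompactSupport (hη i hi).1.continuous (hη i hi).2.1 hW
  have hV : ∀ i ∈ t, MemLp (fun x => η i x • H x + W x • gradient (η i) x) (ENNReal.ofReal p)
      volume := fun i hi =>
    (memLp_smul_of_hasCompactSupport (hη i hi).1.continuous (hη i hi).2.1 hH).add
      (memLp_smul_vector_of_hasCompactSupport (continuous_gradient_of_contDiff (hη1 i hi))
        (hasCompactSupport_gradient (hη i hi).2.1) hW)
  have hex : ∀ i ∈ t, ∃ φ : ℕ → E n → ℝ, (∀ k, IsTestFunction Ω (φ k)) ∧
      GradTendsto Ω p φ (fun x => η i x * W x)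
        (fun x => η i x • H x + W x • gradient (η i) x) := by
    intro i hi
    refine (hC i).exists_testFunction_tendsto hp (hU i hi) (hV i hi)
      (hWH.smooth_mul (hη i hi).1) (hη i hi).2.1 (hη i hi).2.2 fun x hx => ⟨?_, ?_⟩
    · by_contra h
      exact hx (by simp [hW0 x h])
    · exact subset_tsupport _ (left_ne_zero_of_mul hx)
  choose! φ hφ hφt using hex
  refine ⟨fun k x => ∑ i ∈ t, φ i k x, fun k => IsTestFunction.sum t fun i hi => hφ i hi k, ?_⟩
  refine (GradTendsto.sum hp t hφt (fun i hi k => (hφ i hi k).1)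
    (fun i hi => (hU i hi).1.restrict) (fun i hi => (hV i hi).1.restrict)).congr_right ?_ ?_
  · filter_upwards [ae_restrict_mem hΩ.isOpen.measurableSet] with x hx
    rw [← Finset.sum_mul, hsum x (subset_closure hx), one_mul]
  · filter_upwards [ae_restrict_mem hΩ.isOpen.measurableSet] with x hx
    have h1 : ∑ i ∈ t, gradient (η i) x = 0 := by
      have h2 : (fun x => ∑ i ∈ t, η i x) =ᶠ[𝓝 x] fun _ => 1 := by
        filter_upwards [hΩ.isOpen.mem_nhds hx] with y hy
        exact hsum y (subset_closure hy)
      have h3 := h2.fderiv_eq (𝕜 := ℝ)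
      rw [fderiv_fun_sum fun i hi => (hη1 i hi).differentiable one_ne_zero x,
        fderiv_fun_const, Pi.zero_apply] at h3
      simp only [gradient]
      rw [← map_sum, h3, map_zero]
    rw [Finset.sum_add_distrib, ← Finset.sum_smul, ← Finset.smul_sum, h1,
      hsum x (subset_closure hx), one_smul, smul_zero, add_zero]

/-! ### Weak gradients, zero boundary values and smooth approximation -/

theorem IsTestFunction.integrable_smul {n : ℕ} {F : Type*} [NormedAddCommGroup F]
    [NormedSpace ℝ F] {Ω : Set (E n)} {ψ : E n → ℝ} (hψ : IsTestFunction Ω ψ) {G : E n → F}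
    (hG : LocallyIntegrableOn G Ω) : Integrable fun x => ψ x • G x := by
  have h1 : IntegrableOn G (tsupport ψ) := hG.integrableOn_compact_subset hψ.2.2 hψ.2.1
  have h2 : IntegrableOn (fun x => ψ x • G x) (tsupport ψ) :=
    h1.continuousOn_smul hψ.1.continuous.continuousOn hψ.2.1
  rwa [integrableOn_iff_integrable_of_support_subset] at h2
  intro x hx
  exact subset_tsupport _ (left_ne_zero_of_smul hx)

theorem IsTestFunction.setIntegral_mul {n : ℕ} {Ω : Set (E n)} {ψ : E n → ℝ}
    (hψ : IsTestFunction Ω ψ) (f : E n → ℝ) : ∫ x in Ω, f x * ψ x = ∫ x, f x * ψ x := by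
  refine setIntegral_eq_integral_of_forall_compl_eq_zero fun x hx => ?_
  rw [image_eq_zero_of_notMem_tsupport fun h => hx (hψ.2.2 h), mul_zero]

theorem IsTestFunction.setIntegral_mul_gradient {n : ℕ} {Ω : Set (E n)} {ψ : E n → ℝ}
    (hψ : IsTestFunction Ω ψ) (f : E n → ℝ) (i : Fin n) :
    ∫ x in Ω, f x * gradient ψ x i = ∫ x, f x * gradient ψ x i := by
  refine setIntegral_eq_integral_of_forall_compl_eq_zero fun x hx => ?_
  rw [gradient_apply_eq_fderiv, image_eq_zero_of_notMem_tsupport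
    fun h => hx (hψ.2.2 (tsupport_fderiv_subset ℝ h)), zero_apply, mul_zero]

theorem IsWeakGradient.ae_eq {n : ℕ} {Ω : Set (E n)} (hΩ : IsOpen Ω) {u : E n → ℝ}
    {G G' : E n → E n} (h : IsWeakGradient Ω u G) (h' : IsWeakGradient Ω u G') :
    G =ᵐ[volume.restrict Ω] G' := by
  have key : ∀ i : Fin n, ∀ᵐ x, x ∈ Ω →
      (EuclideanSpace.proj i : E n →L[ℝ] ℝ) (G x - G' x) = 0 := by
    intro i
    refine hΩ.ae_eq_zero_of_integral_contDiff_smul_eq_zero (μ := volume) ?_ ?_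
    · intro x hx
      obtain ⟨s, hs, hi⟩ := (h.2.1.sub h'.2.1) x hx
      exact ⟨s, hs, (EuclideanSpace.proj i : E n →L[ℝ] ℝ).integrable_comp hi⟩
    · intro ψ hψ hψc hψs
      have hψt : IsTestFunction Ω ψ := ⟨hψ, hψc, hψs⟩
      have h1 := h.2.2 ψ hψt i
      rw [h'.2.2 ψ hψt i, neg_inj, hψt.setIntegral_mul (fun x => G x i),
        hψt.setIntegral_mul (fun x => G' x i)] at h1
      have hi : ∀ {V : E n → E n}, LocallyIntegrableOn V Ω → Integrable fun x => V x i * ψ x := by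
        intro V hV
        have := (EuclideanSpace.proj i : E n →L[ℝ] ℝ).integrable_comp (hψt.integrable_smul hV)
        simpa [mul_comm] using this
      rw [← sub_eq_zero, ← integral_sub (hi h'.2.1) (hi h.2.1)] at h1
      rw [← neg_eq_zero, ← integral_neg, ← h1]
      congr 1 with x
      change -(ψ x * (G x i - G' x i)) = _
      ring
  rw [EventuallyEq, ae_restrict_iff' hΩ.measurableSet]
  filter_upwards [ae_all_iff.2 key] with x hx hxΩ
  rw [← sub_eq_zero]
  ext i
  exact hx i hxΩ

theorem IsWeakGradient.mono {n : ℕ} {Ω : Set (E n)} {W : E n → ℝ} {H : E n → E n}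
    (h : IsWeakGradient univ W H) : IsWeakGradient Ω W H := by
  refine ⟨h.1.mono_set (subset_univ _), h.2.1.mono_set (subset_univ _), fun ψ hψ i => ?_⟩
  have h1 := h.2.2 ψ ⟨hψ.1, hψ.2.1, subset_univ _⟩ i
  rw [Measure.restrict_univ] at h1
  rw [hψ.setIntegral_mul_gradient, hψ.setIntegral_mul (fun x => H x i), h1]

theorem weakGradient_ae_eq {n : ℕ} {Ω : Set (E n)} (hΩ : IsOpen Ω) {u : E n → ℝ}
    {G : E n → E n} (h : IsWeakGradient Ω u G) :
    weakGradient Ω u =ᵐ[volume.restrict Ω] G :=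
  (isWeakGradient_weakGradient ⟨G, h⟩).ae_eq hΩ h

theorem IsBoundedLipschitzDomain.memSobolevZero {n : ℕ} [NeZero n] {Ω : Set (E n)}
    (hΩ : IsBoundedLipschitzDomain Ω) {p : ℝ} (hp : 1 ≤ p)
    {W : E n → ℝ} {H : E n → E n} (hW : MemLp W (ENNReal.ofReal p) volume)
    (hH : MemLp H (ENNReal.ofReal p) volume) (hWH : IsWeakGradient univ W H)
    (hW0 : ∀ x ∉ Ω, W x = 0) : MemSobolevZero Ω p W := by
  have h1 := weakGradient_ae_eq hΩ.isOpen (hWH.mono (Ω := Ω))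
  refine ⟨⟨hW.restrict Ω, ⟨H, hWH.mono⟩, (memLp_congr_ae h1).2 (hH.restrict Ω)⟩, ?_⟩
  obtain ⟨φ, hφ, hlim⟩ := hΩ.exists_testFunction_tendsto hp hW hH hWH hW0
  exact ⟨φ, hφ, hlim.congr_right EventuallyEq.rfl h1.symm⟩

/-- A function of `W^{1,p}(ℝⁿ)` with bounded support and vanishing gradient is zero: its mollified
versions are constants of compact support. -/
theorem IsWeakGradient.ae_eq_zero {n : ℕ} [NeZero n] {Ω : Set (E n)} (hΩ : Bornology.IsBounded Ω)
    {p : ℝ} (hp : 1 ≤ p) {W : E n → ℝ} {H : E n → E n} (hW : MemLp W (ENNReal.ofReal p) volume)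
    (hWH : IsWeakGradient univ W H) (hW0 : ∀ x ∉ Ω, W x = 0) (hH : H =ᵐ[volume] 0) :
    W =ᵐ[volume] 0 := by
  have hp1 : 1 ≤ ENNReal.ofReal p := by simpa using hp
  have hWl : LocallyIntegrable W := hW.locallyIntegrable hp1
  have hpos : ∀ k : ℕ, (0 : ℝ) < 1 / (k + 1) := fun k => by positivity
  choose K hKs hKc hK0 hK1 hKb using fun k => exists_kernel (0 : E n) (hpos k)
  have hlim := tendsto_eLpNorm_mollify_sub (fun k => (hKs k).continuous) hKc hK0 hK1
    (tendsto_one_div_add_atTop_nhds_zero_nat (𝕜 := ℝ))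
    (fun k z hz => (mem_ball_zero_iff.1 (hKb k z hz)).le) hp hW
  have hzero : ∀ k x, mollify (K k) W x = 0 := by
    intro k x
    have hd : Differentiable ℝ (mollify (K k) W) :=
      (contDiff_mollify (hKs k) (hKc k) hWl).differentiable (by simp)
    have hf : ∀ x, fderiv ℝ (mollify (K k) W) x = 0 := by
      intro x
      ext v
      rw [← inner_gradient_left, gradient_mollify (hKs k) (hKc k) hWH, mollify_apply,
        integral_eq_zero_of_ae, inner_zero_left, zero_apply]
      filter_upwards [hH] with y hy
      simp [hy]
    obtain ⟨R, hR⟩ := hΩ.exists_norm_le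
    obtain ⟨y, hy⟩ := NormedSpace.exists_lt_norm ℝ (E n) (R + 1 / (k + 1))
    rw [is_const_of_fderiv_eq_zero hd hf x y]
    by_contra h
    obtain ⟨z, hz, hz'⟩ := exists_of_mollify_ne_zero h
    have h1 := mem_ball_zero_iff.1 (hKb k z hz)
    have h2 : y - z ∈ Ω := by
      by_contra h
      exact hz' (hW0 _ h)
    have h3 := norm_sub_norm_le y z
    have h4 := hR _ h2
    linarith
  have h1 : eLpNorm W (ENNReal.ofReal p) volume = 0 := by
    refine tendsto_nhds_unique (tendsto_const_nhds (f := atTop)) (hlim.congr fun k => ?_)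
    rw [← eLpNorm_neg]
    congr 1 with x
    simp [hzero]
  exact (eLpNorm_eq_zero_iff hW.1 (zero_lt_one.trans_le hp1).ne').1 h1

/-- Some smooth functions converge to `w` in `L^p(Ω)`, with gradients converging to `H` in
`L^p(Ω)` and boundary values converging to `g` in `L^p(∂Ω)`. This relation between `w`, `H` and `g`
is linear, so that traces are never compared for different approximating sequences and uniqueness
of traces plays no role. -/
def HasSmoothApprox {n : ℕ} (Ω : Set (E n)) (p : ℝ) (w : E n → ℝ) (H : E n → E n)
    (g : E n → ℝ) : Prop :=
  MemLp w (ENNReal.ofReal p) (volume.restrict Ω) ∧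
    MemLp H (ENNReal.ofReal p) (volume.restrict Ω) ∧
    MemLp g (ENNReal.ofReal p) (surfaceMeasure Ω) ∧
    ∃ φ : ℕ → E n → ℝ, (∀ k, ContDiff ℝ ∞ (φ k)) ∧ GradTendsto Ω p φ w H ∧
      Tendsto (fun k => eLpNorm (fun x => φ k x - g x) (ENNReal.ofReal p) (surfaceMeasure Ω))
        atTop (𝓝 0)

theorem IsTrace.hasSmoothApprox {n : ℕ} {Ω : Set (E n)} {p : ℝ} {u g : E n → ℝ}
    (h : IsTrace Ω p u g) : HasSmoothApprox Ω p u (weakGradient Ω u) g := by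
  obtain ⟨hu, hg, φ, hφ, hlim, hbd⟩ := h
  exact ⟨hu.1, hu.2.2, hg, φ, hφ, hlim, hbd⟩

theorem HasSmoothApprox.add {n : ℕ} {Ω : Set (E n)} {p : ℝ} (hp : 1 ≤ p) {w w' g g' : E n → ℝ}
    {H H' : E n → E n} (h : HasSmoothApprox Ω p w H g) (h' : HasSmoothApprox Ω p w' H' g') :
    HasSmoothApprox Ω p (fun x => w x + w' x) (fun x => H x + H' x) (fun x => g x + g' x) := by
  obtain ⟨hw, hH, hg, φ, hφ, hlim, hbd⟩ := h
  obtain ⟨hw', hH', hg', φ', hφ', hlim', hbd'⟩ := h'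
  refine ⟨hw.add hw', hH.add hH', hg.add hg', _, fun k => (hφ k).add (hφ' k),
    hlim.add hp hlim' hφ hφ' hw.1 hw'.1 hH.1 hH'.1, ?_⟩
  have h1 := hbd.add hbd'
  rw [add_zero] at h1
  refine tendsto_of_tendsto_of_tendsto_of_le_of_le tendsto_const_nhds h1 (fun _ => zero_le)
    fun k => le_trans (le_of_eq ?_) (eLpNorm_add_le
      ((hφ k).continuous.aestronglyMeasurable.sub hg.1)
      ((hφ' k).continuous.aestronglyMeasurable.sub hg'.1) (by simpa using hp))
  congr 1 with x
  simp only [Pi.add_apply]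
  ring

theorem HasSmoothApprox.neg {n : ℕ} {Ω : Set (E n)} {p : ℝ} {w g : E n → ℝ}
    {H : E n → E n} (h : HasSmoothApprox Ω p w H g) :
    HasSmoothApprox Ω p (fun x => -w x) (fun x => -H x) (fun x => -g x) := by
  obtain ⟨hw, hH, hg, φ, hφ, hlim, hbd⟩ := h
  refine ⟨hw.neg, hH.neg, hg.neg, _, fun k => (hφ k).neg, hlim.neg, hbd.congr fun k => ?_⟩
  rw [← eLpNorm_neg]
  congr 1 with x
  simp only [Pi.neg_apply]
  ring

theorem hasSmoothApprox_sub_of_boundary {n : ℕ} {Ω : Set (E n)} {p : ℝ} (hp : 1 ≤ p)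
    {u v u₀ v₀ : E n → ℝ} (hu : BoundaryEq Ω p u u₀) (hv : BoundaryEq Ω p v v₀)
    (hle : BoundaryLE Ω p v₀ u₀) :
    ∃ g : E n → ℝ, g ≤ᵐ[surfaceMeasure Ω] 0 ∧
      HasSmoothApprox Ω p (fun x => v x - u x)
        (fun x => weakGradient Ω v x - weakGradient Ω u x) g := by
  obtain ⟨g₁, hu₁, hu₂⟩ := hu
  obtain ⟨g₂, hv₁, hv₂⟩ := hv
  obtain ⟨g, h, hg, hh, hgh⟩ := hle
  -- write `v - u = (v - v₀) + (v₀ - u₀) + (u₀ - u)`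
  have key := ((hv₁.hasSmoothApprox.add hp hv₂.hasSmoothApprox.neg).add hp
    (hg.hasSmoothApprox.add hp hh.hasSmoothApprox.neg)).add hp
    (hu₂.hasSmoothApprox.add hp hu₁.hasSmoothApprox.neg)
  refine ⟨fun x => g₂ x + -g₂ x + (g x + -h x) + (g₁ x + -g₁ x), ?_, ?_⟩
  · filter_upwards [hgh] with x hx
    simp only [Pi.zero_apply]
    linarith
  · convert! key using 1
    · ext x; ring
    · ext1 x; abel

/-! ### Monotonicity of the double phase operator -/

section PowerVec

variable {n : ℕ} {r : ℝ}

theorem norm_powerVec (hr : 1 < r) (ξ : E n) : ‖powerVec r ξ‖ = ‖ξ‖ ^ (r - 1) := by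
  rcases eq_or_ne ξ 0 with rfl | hξ
  · rw [powerVec, smul_zero, norm_zero, Real.zero_rpow (by linarith)]
  · have h := norm_pos_iff.2 hξ
    rw [powerVec, norm_smul, Real.norm_of_nonneg (by positivity)]
    nth_rewrite 2 [← Real.rpow_one ‖ξ‖]
    rw [← Real.rpow_add h]
    congr 1
    ring

theorem inner_powerVec_self (hr : 1 < r) (ξ : E n) :
    inner ℝ (powerVec r ξ) ξ = ‖ξ‖ ^ (r - 1) * ‖ξ‖ := by
  rw [← norm_powerVec hr, powerVec, real_inner_smul_left, real_inner_self_eq_norm_sq, norm_smul,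
    Real.norm_of_nonneg (by positivity)]
  ring

theorem le_inner_powerVec_sub (hr : 1 < r) (ξ η : E n) :
    (‖ξ‖ ^ (r - 1) - ‖η‖ ^ (r - 1)) * (‖ξ‖ - ‖η‖) ≤
      inner ℝ (powerVec r ξ - powerVec r η) (ξ - η) := by
  have h1 := real_inner_le_norm (powerVec r ξ) η
  have h2 := real_inner_le_norm (powerVec r η) ξ
  rw [norm_powerVec hr] at h1 h2
  rw [inner_sub_left, inner_sub_right, inner_sub_right, inner_powerVec_self hr,
    inner_powerVec_self hr]
  linarith

theorem inner_powerVec_sub_nonneg (hr : 1 < r) (ξ η : E n) :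
    0 ≤ inner ℝ (powerVec r ξ - powerVec r η) (ξ - η) := by
  refine le_trans ?_ (le_inner_powerVec_sub hr ξ η)
  rcases le_total ‖ξ‖ ‖η‖ with h | h
  · exact mul_nonneg_of_nonpos_of_nonpos
      (sub_nonpos.2 (Real.rpow_le_rpow (norm_nonneg _) h (by linarith))) (sub_nonpos.2 h)
  · exact mul_nonneg
      (sub_nonneg.2 (Real.rpow_le_rpow (norm_nonneg _) h (by linarith))) (sub_nonneg.2 h)

theorem eq_of_inner_powerVec_sub_eq_zero (hr : 1 < r) {ξ η : E n}
    (h : inner ℝ (powerVec r ξ - powerVec r η) (ξ - η) = 0) : ξ = η := by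
  have h1 := le_inner_powerVec_sub hr ξ η
  rw [h] at h1
  have h2 : ‖ξ‖ = ‖η‖ := by
    by_contra hne
    rcases lt_or_gt_of_ne hne with hlt | hlt
    · have := Real.rpow_lt_rpow (norm_nonneg _) hlt (sub_pos.2 hr)
      nlinarith
    · have := Real.rpow_lt_rpow (norm_nonneg _) hlt (sub_pos.2 hr)
      nlinarith
  rw [powerVec, powerVec, h2, ← smul_sub, real_inner_smul_left, real_inner_self_eq_norm_sq,
    mul_eq_zero] at h
  rcases h with h | h
  · -- a power of `‖η‖` vanishes only for `η = 0`
    have h3 := ((Real.rpow_eq_zero_iff_of_nonneg (norm_nonneg η)).1 h).1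
    rw [norm_eq_zero.1 h3]
    rwa [h3, norm_eq_zero] at h2
  · exact sub_eq_zero.1 (norm_eq_zero.1 (pow_eq_zero_iff two_ne_zero |>.1 h))

theorem measurable_powerVec : Measurable (powerVec r : E n → E n) := by
  unfold powerVec
  fun_prop

theorem abs_inner_powerVec_le (hr : 1 < r) (ξ η : E n) :
    |inner ℝ (powerVec r ξ) η| ≤ ‖ξ‖ ^ r + ‖η‖ ^ r := by
  have h1 := abs_real_inner_le_norm (powerVec r ξ) η
  rw [norm_powerVec hr] at h1
  refine h1.trans ?_
  have key : ∀ s : ℝ, 0 ≤ s → s ^ (r - 1) * s = s ^ r := by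
    intro s hs
    conv_lhs => rw [← Real.rpow_one s, ← Real.rpow_mul hs, one_mul]
    rw [← Real.rpow_add_of_nonneg hs (by linarith) zero_le_one, sub_add_cancel]
  rcases le_total ‖ξ‖ ‖η‖ with h | h
  · calc ‖ξ‖ ^ (r - 1) * ‖η‖ ≤ ‖η‖ ^ (r - 1) * ‖η‖ := by
          gcongr
      _ = ‖η‖ ^ r := key _ (norm_nonneg _)
      _ ≤ _ := le_add_of_nonneg_left (by positivity)
  · calc ‖ξ‖ ^ (r - 1) * ‖η‖ ≤ ‖ξ‖ ^ (r - 1) * ‖ξ‖ := by gcongr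
      _ = ‖ξ‖ ^ r := key _ (norm_nonneg _)
      _ ≤ _ := le_add_of_nonneg_right (by positivity)

theorem norm_sub_rpow_le (hr : 0 ≤ r) (ξ η : E n) :
    ‖ξ - η‖ ^ r ≤ 2 ^ r * (‖ξ‖ ^ r + ‖η‖ ^ r) := by
  have h0 := norm_sub_le ξ η
  rcases le_total ‖ξ‖ ‖η‖ with h | h
  · calc ‖ξ - η‖ ^ r ≤ (2 * ‖η‖) ^ r :=
          Real.rpow_le_rpow (norm_nonneg _) (by linarith) hr
      _ = 2 ^ r * ‖η‖ ^ r := Real.mul_rpow (by norm_num) (norm_nonneg _)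
      _ ≤ _ := by gcongr; exact le_add_of_nonneg_left (by positivity)
  · calc ‖ξ - η‖ ^ r ≤ (2 * ‖ξ‖) ^ r :=
          Real.rpow_le_rpow (norm_nonneg _) (by linarith) hr
      _ = 2 ^ r * ‖ξ‖ ^ r := Real.mul_rpow (by norm_num) (norm_nonneg _)
      _ ≤ _ := by gcongr; exact le_add_of_nonneg_right (by positivity)

end PowerVec

/-! ### Comparison principle -/

theorem integrable_inner_doublePhase {n : ℕ} {μ : Measure (E n)} {a : E n → ℝ} {p q : ℝ}
    (hp : 1 < p) (hq : 1 < q) (ham : AEStronglyMeasurable a μ) (ha : ∀ᵐ x ∂μ, 0 ≤ a x)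
    {G ζ : E n → E n} (hG : MemLp G (ENNReal.ofReal p) μ) (hζ : MemLp ζ (ENNReal.ofReal p) μ)
    (hGq : Integrable (fun x => a x * ‖G x‖ ^ q) μ)
    (hζq : Integrable (fun x => a x * ‖ζ x‖ ^ q) μ) :
    Integrable (fun x => inner ℝ (powerVec p (G x) + a x • powerVec q (G x)) (ζ x)) μ := by
  have hpn : ENNReal.ofReal p ≠ 0 := by simpa using zero_lt_one.trans hp
  have hGp := hG.integrable_norm_rpow hpn ENNReal.ofReal_ne_top
  have hζp := hζ.integrable_norm_rpow hpn ENNReal.ofReal_ne_top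
  rw [ENNReal.toReal_ofReal (by linarith)] at hGp hζp
  have hm : ∀ r, AEStronglyMeasurable (fun x => powerVec r (G x)) μ := fun r =>
    (measurable_powerVec.comp_aemeasurable hG.1.aemeasurable).aestronglyMeasurable
  refine ((hGp.add hζp).add (hGq.add hζq)).mono' (((hm p).add (ham.smul (hm q))).inner hζ.1) ?_
  filter_upwards [ha] with x hx
  rw [inner_add_left, real_inner_smul_left]
  refine (norm_add_le _ _).trans (add_le_add (abs_inner_powerVec_le hp _ _) ?_)
  rw [norm_mul, Real.norm_of_nonneg hx, Pi.add_apply, ← mul_add]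
  exact mul_le_mul_of_nonneg_left (abs_inner_powerVec_le hq _ _) hx

/-- The comparison principle: `W = (v - u)⁺` is an admissible test function in both equations, and
strict monotonicity of the operator forces `∇W = 0`. -/
theorem ae_le_of_isSolution {n : ℕ} [NeZero n] {Ω : Set (E n)} (hΩ : IsBoundedLipschitzDomain Ω)
    {p q : ℝ} (hp : 1 < p) (hpq : p ≤ q) {a : E n → ℝ} (ha : MemLp a ⊤ (volume.restrict Ω))
    (ha_nonneg : ∀ᵐ x ∂(volume.restrict Ω), 0 ≤ a x) {u₀ v₀ u v : E n → ℝ}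
    (hu : IsSolution Ω a p q u₀ u) (hv : IsSolution Ω a p q v₀ v) (hle : BoundaryLE Ω p v₀ u₀) :
    ∀ᵐ x ∂(volume.restrict Ω), v x ≤ u x := by
  have hΩm : MeasurableSet Ω := hΩ.isOpen.measurableSet
  have hq : 1 < q := hp.trans_le hpq
  obtain ⟨g, hg, hw, hH, -, φ, hφ, hlim, hbd⟩ :=
    hasSmoothApprox_sub_of_boundary hp.le hu.boundary hv.boundary hle
  set Gu := weakGradient Ω u
  set Gv := weakGradient Ω v
  have hWH := isWeakGradient_univ_posPart hΩ hp.le hφ hw hH hlim hg hbd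
  set W : E n → ℝ := Ω.indicator fun x => max (v x - u x) 0 with hWdef
  set H : E n → E n := Ω.indicator fun x => if 0 < v x - u x then Gv x - Gu x else 0 with hHdef
  have hW0 : ∀ x ∉ Ω, W x = 0 := fun x hx => indicator_of_notMem hx _
  have hWm : AEStronglyMeasurable W volume :=
    (locallyIntegrableOn_univ.1 hWH.1).aestronglyMeasurable
  have hHm : AEStronglyMeasurable H volume :=
    (locallyIntegrableOn_univ.1 hWH.2.1).aestronglyMeasurable
  have hWp : MemLp W (ENNReal.ofReal p) volume := by
    refine ((memLp_indicator_iff_restrict hΩm).2 hw).mono hWm (ae_of_all _ fun x => ?_)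
    by_cases hx : x ∈ Ω
    · simp only [hWdef, indicator_of_mem hx, Real.norm_eq_abs]
      rw [abs_of_nonneg (le_max_right _ _)]
      exact max_le (le_abs_self _) (abs_nonneg _)
    · simp [hWdef, hx]
  have hHle : ∀ x, ‖H x‖ ≤ ‖Gv x - Gu x‖ := by
    intro x
    by_cases hx : x ∈ Ω
    · simp only [hHdef, indicator_of_mem hx]
      split_ifs
      · exact le_rfl
      · simp
    · simp [hHdef, hx]
  have hHp : MemLp H (ENNReal.ofReal p) volume := by
    refine ((memLp_indicator_iff_restrict hΩm).2 hH).mono hHm (ae_of_all _ fun x => ?_)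
    by_cases hx : x ∈ Ω
    · simpa [hx] using hHle x
    · simp [hHdef, hx]
  have hζ : weakGradient Ω W =ᵐ[volume.restrict Ω] H :=
    weakGradient_ae_eq hΩ.isOpen hWH.mono
  have hzero : MemSobolevZero Ω p W := hΩ.memSobolevZero hp.le hWp hHp hWH hW0
  -- the positive part of `v - u` is an admissible test function
  have hζq : IntegrableOn (fun x => a x * ‖weakGradient Ω W x‖ ^ q) Ω := by
    have hm := hzero.1.2.2.1.norm.aemeasurable.pow_const q
    refine ((hv.mem.2.add hu.mem.2).const_mul (2 ^ q)).mono'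
      (ha.1.mul hm.aestronglyMeasurable) ?_
    filter_upwards [ha_nonneg, hζ] with x hx hx'
    rw [norm_mul, Real.norm_of_nonneg hx, Real.norm_of_nonneg (by positivity), hx', Pi.add_apply,
      ← mul_add, mul_left_comm]
    refine mul_le_mul_of_nonneg_left ?_ hx
    exact (Real.rpow_le_rpow (norm_nonneg _) (hHle x) (by linarith)).trans
      (norm_sub_rpow_le (by linarith) _ _)
  have hW : MemDoublePhaseZero Ω a p q W := ⟨hzero, hzero.1, hζq⟩
  have hint : ∀ {G : E n → E n}, MemLp G (ENNReal.ofReal p) (volume.restrict Ω) →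
      IntegrableOn (fun x => a x * ‖G x‖ ^ q) Ω →
      IntegrableOn (fun x => inner ℝ (powerVec p (G x) + a x • powerVec q (G x))
        (weakGradient Ω W x)) Ω := fun hG hGq =>
    integrable_inner_doublePhase hp hq ha.1 ha_nonneg hG hzero.1.2.2 hGq hζq
  have hiu := hint hu.mem.1.2.2 hu.mem.2
  have hiv := hint hv.mem.1.2.2 hv.mem.2
  have hdiff := integral_sub hiv hiu
  rw [hv.weak_eq W hW, hu.weak_eq W hW, sub_zero] at hdiff
  -- at almost every point of `Ω` the integrand is nonnegative, and zero only if `H` vanishes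
  have hpt : ∀ᵐ x ∂(volume.restrict Ω),
      0 ≤ inner ℝ (powerVec p (Gv x) + a x • powerVec q (Gv x)) (weakGradient Ω W x) -
        inner ℝ (powerVec p (Gu x) + a x • powerVec q (Gu x)) (weakGradient Ω W x) ∧
      (inner ℝ (powerVec p (Gv x) + a x • powerVec q (Gv x)) (weakGradient Ω W x) -
        inner ℝ (powerVec p (Gu x) + a x • powerVec q (Gu x)) (weakGradient Ω W x) = 0 →
        H x = 0) := by
    filter_upwards [ha_nonneg, hζ, ae_restrict_mem hΩm] with x hx hx' hxΩ
    have hHx : H x = if 0 < v x - u x then Gv x - Gu x else 0 := indicator_of_mem hxΩ _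
    rw [hx', hHx]
    split_ifs with h
    · have h1 := inner_powerVec_sub_nonneg hp (Gv x) (Gu x)
      have h2 := mul_nonneg hx (inner_powerVec_sub_nonneg hq (Gv x) (Gu x))
      have h3 : inner ℝ (powerVec p (Gv x) + a x • powerVec q (Gv x)) (Gv x - Gu x) -
          inner ℝ (powerVec p (Gu x) + a x • powerVec q (Gu x)) (Gv x - Gu x)
          = inner ℝ (powerVec p (Gv x) - powerVec p (Gu x)) (Gv x - Gu x) +
            a x * inner ℝ (powerVec q (Gv x) - powerVec q (Gu x)) (Gv x - Gu x) := by
        simp only [inner_add_left, inner_sub_left, real_inner_smul_left]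
        ring
      rw [h3]
      refine ⟨add_nonneg h1 h2, fun h4 => ?_⟩
      have h5 := eq_of_inner_powerVec_sub_eq_zero hp
        (le_antisymm (by linarith) h1)
      rw [h5, sub_self]
    · simp
  have hae := (integral_eq_zero_iff_of_nonneg_ae (hpt.mono fun x hx => hx.1)
    (hiv.sub hiu)).1 hdiff
  have hH0 : H =ᵐ[volume] 0 := by
    have h1 : ∀ᵐ x ∂(volume.restrict Ω), H x = 0 := by
      filter_upwards [hpt, hae] with x hx hx'
      exact hx.2 hx'
    rw [ae_restrict_iff' hΩm] at h1
    filter_upwards [h1] with x hx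
    by_cases hxΩ : x ∈ Ω
    · exact hx hxΩ
    · exact indicator_of_notMem hxΩ _
  have hWz := hWH.ae_eq_zero hΩ.isBounded hp.le hWp hW0 hH0
  rw [ae_restrict_iff' hΩm]
  filter_upwards [hWz] with x hx hxΩ
  have h1 : max (v x - u x) 0 = 0 := by
    rw [hWdef, indicator_of_mem hxΩ] at hx
    exact hx
  have h2 := le_max_left (v x - u x) 0
  linarith

end DoublePhase

end

theorem mainTheorem6 {n : ℕ} (hn : 2 ≤ n) {Ω : Set (DoublePhase.E n)}
    (hΩ : DoublePhase.IsBoundedLipschitzDomain Ω)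
    {p q : ℝ} (hp : 1 < p) (hpq : p ≤ q)
    {a : DoublePhase.E n → ℝ} (ha : MemLp a ⊤ (volume.restrict Ω))
    (ha_nonneg : ∀ᵐ x ∂(volume.restrict Ω), 0 ≤ a x)
    {u₀ v₀ u v : DoublePhase.E n → ℝ}
    (hu₀ : DoublePhase.MemSobolev Ω q u₀) (hv₀ : DoublePhase.MemSobolev Ω q v₀)
    (hu : DoublePhase.IsSolution Ω a p q u₀ u) (hv : DoublePhase.IsSolution Ω a p q v₀ v)
    (hle : DoublePhase.BoundaryLE Ω p v₀ u₀) :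
    ∀ᵐ x ∂(volume.restrict Ω), v x ≤ u x := by
  have : NeZero n := ⟨by omega⟩
  exact DoublePhase.ae_le_of_isSolution hΩ hp hpq ha ha_nonneg hu hv hle
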